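/- A two-dimensional Lévy-type process $F=\{F_t\}_{t\ge0}$ is a conservative Feller process on $\mathbb R^2$ whose generator $\mathcal A$ has $C_c^\infty(\mathbb R^2)$ in its domain and satisfies $\mathcal A f(x)=-\int_{\mathbb R^2} q(x,\xi)e^{i\langle\xi,x\rangle}\hat f(\xi)\,d\xi$ there, where $\hat f(\xi)=(2\pi)^{-2}\int e^{-i\langle\xi,x\rangle}f(x)\,dx$ and the symbol $q$ has for each $x$ a Lévy–Khintchine representation $$q(x,\xi)=a(x)-i\langle\xi,b(x)\rangle+\tfrac12\langle\xi,C(x)\xi\rangle+\int_{\mathbb R^2}\bigl(1-e^{i\langle\xi,y\rangle}+i\langle\xi,y\rangle 1_{B_1(0)}(y)\bigr)\,\nu(x,dy)$$ (with $a\ge0$, $b$, the symmetric non-negative definite $C$ and the Lévy kernel $\nu$ Borel measurable in $x$), $|q(x,\xi)|\le c(1+|\xi|^2)$ for some finite $c$ and all $x,\xi$, and $q(x,0)=0$ for all $x$. A Lévy process $L$ with symbol $q_L$ and Lévy measure $\nu_L$ satisfies $\mathbb E^x[e^{i\langle\xi,L_t-x\rangle}]=e^{-tq_L(\xi)}$,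 with $q_L$ given by a Lévy–Khintchine formula with $a=0$ and with Lévy measure $\nu_L$. It is recurrent (transient) if $\int_0^\infty\mathbb P^x(L_t\in B_r(x))\,dt$ is $=\infty$ (is $<\infty$) for all $x\in\mathbb R^2$ and all $r>0$. A function on $\mathbb R^2$ is radial if it is invariant under rotations. A symmetric Borel measure $\mu$ on $\mathbb R$ is quasi-unimodal if for some $u_1\ge0$ the function $u\mapsto\mu((u,\infty))$ is finite and convex on $(u_1,\infty)$. For Lévy measures $\mu,\mu'$ on $\mathbb R^2$ say that the tails of $\mu$ dominate those of $\mu'$ if there is $u_0\ge0$ such that either $\mu(B_u(0)^c)\ge\mu'(B_u(0)^c)$ for all $u\ge u_0$, or $\mu((u,\infty)\times\mathbb R)\ge\mu'((u,\infty)\times\mathbb R)$ for all $u\ge u_0$. **Corollary.** Let $F$ be a two-dimensional Lévy-type process with symbol $q(x,\xi)$ and Lévy measure $\nu(x,dy)$, such that $\xi\mapsto q(x,\xi)$ is radial for every $x$ (so that $q$ is real and non-negative). Let $L$ be a two-dimensional Lévy process with radial symbol $q_L(\xi)$ and Lévy measure $\nu_L(dy)$, and let $x_0\in\mathbb R^2$.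 (a) Suppose that $\sup_{x\in\mathbb R^2}q(x,\xi)=q(x_0,\xi)$ for all $|\xi|$ small enough, that $\nu_L(du\times\mathbb R)$ is quasi-unimodal, and that the tails of $\nu_L$ dominate those of $\nu(x_0,\cdot)$. If $L$ is recurrent, then $$\int_{B_r(0)}\frac{d\xi}{\sup_{x\in\mathbb R^2}|q(x,\xi)|}=\infty\quad\text{for some } r>0.$$ (b) Suppose that $\inf_{x\in\mathbb R^2}q(x,\xi)=q(x_0,\xi)$ for all $|\xi|$ small enough, that $\nu(x_0,du\times\mathbb R)$ is quasi-unimodal, that $\int_{\mathbb R^2}|y|^2\,\nu(x_0,dy)=\infty$, and that the tails of $\nu(x_0,\cdot)$ dominate those of $\nu_L$. If $L$ is transient, then $$\int_{B_r(0)}\frac{d\xi}{\inf_{x\in\mathbb R^2}\operatorname{Re}q(x,\xi)}<\infty\quad\text{for some } r>0.$$ -/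

import Mathlib

open MeasureTheory ProbabilityTheory Filter Topology Set
open scoped NNReal ENNReal

/-! ### Lévy measures and Lévy–Khintchine exponents on `ℝ^d` -/

/-- A Lévy measure on `ℝ^d`: no mass at the origin and `∫ min(1, |y|²) ν(dy) < ∞`. -/
def IsLevyMeasure {d : ℕ} (ν : Measure (EuclideanSpace ℝ (Fin d))) : Prop :=
  ν {0} = 0 ∧ ∫⁻ y, ENNReal.ofReal (min 1 (‖y‖ ^ 2)) ∂ν < ∞

/-- The Lévy–Khintchine expression
`a - i⟨ξ,b⟩ + ½⟨ξ,Cξ⟩ + ∫ (1 - exp(i⟨ξ,y⟩) + i⟨ξ,y⟩ 1_{B_1(0)}(y)) ν(dy)`. -/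
noncomputable def levyKhintchine {d : ℕ} (a : ℝ) (b : EuclideanSpace ℝ (Fin d))
    (C : Matrix (Fin d) (Fin d) ℝ) (ν : Measure (EuclideanSpace ℝ (Fin d)))
    (ξ : EuclideanSpace ℝ (Fin d)) : ℂ :=
  (a : ℂ) - Complex.I * (inner ℝ ξ b : ℝ)
    + (1 / 2 : ℂ) * ((∑ i, ∑ j, ξ i * C i j * ξ j : ℝ) : ℂ)
    + ∫ y, (1 - Complex.exp (Complex.I * (inner ℝ ξ y : ℝ))
        + (Metric.ball (0 : EuclideanSpace ℝ (Fin d)) 1).indicator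
            (fun y => Complex.I * (inner ℝ ξ y : ℝ)) y) ∂ν

/-! ### Lévy processes -/

/-- A path `[0,∞) → ℝ^d` that is right-continuous with left limits. -/
def IsCadlagPath {d : ℕ} (w : ℝ≥0 → EuclideanSpace ℝ (Fin d)) : Prop :=
  ∀ t, ContinuousWithinAt w (Ici t) t ∧ ∃ l, Tendsto w (𝓝[<] t) (𝓝 l)

/-- `L` is a `d`-dimensional Lévy process under the family `P x`, `x ∈ ℝ^d`, of starting points:
under `P x` it starts at `x`, has independent and stationary increments, whose law does not
depend on `x`, and càdlàg paths. -/
structure IsLevyProcess {d : ℕ} {Ω : Type*} [MeasurableSpace Ω]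
    (P : EuclideanSpace ℝ (Fin d) → Measure Ω)
    (L : ℝ≥0 → Ω → EuclideanSpace ℝ (Fin d)) : Prop where
  isProbabilityMeasure : ∀ x, IsProbabilityMeasure (P x)
  measurable : ∀ t, Measurable (L t)
  start : ∀ x, ∀ᵐ ω ∂P x, L 0 ω = x
  indepIncrements : ∀ x, HasIndepIncrements L (P x)
  stationaryIncrements : ∀ x s t,
    (P x).map (fun ω => L (s + t) ω - L s ω) = (P 0).map (L t)
  cadlag : ∀ x, ∀ᵐ ω ∂P x, IsCadlagPath (fun t => L t ω)

/-- The Lévy process `L` has symbol (characteristic exponent) `q` and Lévy measure `ν`: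
`E^x[exp(i⟨ξ, L_t - x⟩)] = exp(-t q(ξ))`, and `q` has a Lévy–Khintchine representation with Lévy
measure `ν`. -/
structure HasLevySymbol {d : ℕ} {Ω : Type*} [MeasurableSpace Ω]
    (P : EuclideanSpace ℝ (Fin d) → Measure Ω)
    (L : ℝ≥0 → Ω → EuclideanSpace ℝ (Fin d))
    (q : EuclideanSpace ℝ (Fin d) → ℂ) (ν : Measure (EuclideanSpace ℝ (Fin d))) : Prop where
  charFun_eq : ∀ x t ξ,
    ∫ ω, Complex.exp (Complex.I * (inner ℝ ξ (L t ω - x) : ℝ)) ∂P x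
      = Complex.exp (-((t : ℝ) : ℂ) * q ξ)
  isLevyMeasure : IsLevyMeasure ν
  exists_representation : ∃ (b : EuclideanSpace ℝ (Fin d)) (C : Matrix (Fin d) (Fin d) ℝ),
    C.PosSemidef ∧ ∀ ξ, q ξ = levyKhintchine 0 b C ν ξ

/-- Recurrence: `∫_0^∞ P^x(L_t ∈ B_r(x)) dt = ∞` for all `x` and all `r > 0`. -/
def IsRecurrentLevy {d : ℕ} {Ω : Type*} [MeasurableSpace Ω]
    (P : EuclideanSpace ℝ (Fin d) → Measure Ω)
    (L : ℝ≥0 → Ω → EuclideanSpace ℝ (Fin d)) : Prop :=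
  ∀ x, ∀ r : ℝ, 0 < r →
    ∫⁻ t in Ioi (0 : ℝ), P x {ω | L t.toNNReal ω ∈ Metric.ball x r} = ∞

/-- Transience: `∫_0^∞ P^x(L_t ∈ B_r(x)) dt < ∞` for all `x` and all `r > 0`. -/
def IsTransientLevy {d : ℕ} {Ω : Type*} [MeasurableSpace Ω]
    (P : EuclideanSpace ℝ (Fin d) → Measure Ω)
    (L : ℝ≥0 → Ω → EuclideanSpace ℝ (Fin d)) : Prop :=
  ∀ x, ∀ r : ℝ, 0 < r →
    ∫⁻ t in Ioi (0 : ℝ), P x {ω | L t.toNNReal ω ∈ Metric.ball x r} < ∞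

/-! ### Feller processes and Lévy-type processes -/

/-- `X` is a (conservative, time-homogeneous) Markov process with state space `ℝ^d` with respect to
the filtration `ℱ` and the family `P x`, `x ∈ ℝ^d`. -/
structure IsMarkovProcess {d : ℕ} {Ω : Type*} {mΩ : MeasurableSpace Ω} (ℱ : Filtration ℝ≥0 mΩ)
    (P : EuclideanSpace ℝ (Fin d) → Measure Ω)
    (X : ℝ≥0 → Ω → EuclideanSpace ℝ (Fin d)) : Prop where
  isProbabilityMeasure : ∀ x, IsProbabilityMeasure (P x)
  adapted : ∀ t, Measurable[ℱ t] (X t)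
  start : ∀ x, ∀ᵐ ω ∂P x, X 0 ω = x
  measurable_transition : ∀ t B, MeasurableSet B → Measurable (fun x => P x (X t ⁻¹' B))
  markov : ∀ x s t B, MeasurableSet B →
    (P x)[(X (s + t) ⁻¹' B).indicator (fun _ => (1 : ℝ)) | ℱ s]
      =ᵐ[P x] fun ω => (P (X s ω)).real (X t ⁻¹' B)

/-- The transition semigroup `P_t f(x) = E^x[f(X_t)]`. -/
noncomputable def transitionOp {d : ℕ} {Ω : Type*} [MeasurableSpace Ω]
    (P : EuclideanSpace ℝ (Fin d) → Measure Ω)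
    (X : ℝ≥0 → Ω → EuclideanSpace ℝ (Fin d))
    (t : ℝ≥0) (f : EuclideanSpace ℝ (Fin d) → ℝ) (x : EuclideanSpace ℝ (Fin d)) : ℝ :=
  ∫ ω, f (X t ω) ∂P x

/-- A Feller process: a Markov process whose semigroup maps `C_∞(ℝ^d)` (continuous functions
vanishing at infinity) into itself and is strongly continuous on it. -/
structure IsFellerProcess {d : ℕ} {Ω : Type*} {mΩ : MeasurableSpace Ω} (ℱ : Filtration ℝ≥0 mΩ)
    (P : EuclideanSpace ℝ (Fin d) → Measure Ω)
    (X : ℝ≥0 → Ω → EuclideanSpace ℝ (Fin d)) : Prop extends IsMarkovProcess ℱ P X where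
  maps_zeroAtInfty : ∀ t (f : ZeroAtInftyContinuousMap (EuclideanSpace ℝ (Fin d)) ℝ),
    ∃ g : ZeroAtInftyContinuousMap (EuclideanSpace ℝ (Fin d)) ℝ, transitionOp P X t f = g
  strongly_continuous : ∀ f : ZeroAtInftyContinuousMap (EuclideanSpace ℝ (Fin d)) ℝ,
    TendstoUniformly (fun t => transitionOp P X t f) f (𝓝[>] 0)

/-- `f` lies in the domain of the infinitesimal generator `A` of the semigroup and `A f = g`, that
is, `(P_t f - f) / t → g` in the supremum norm as `t → 0`. -/
def HasGeneratorValue {d : ℕ} {Ω : Type*} [MeasurableSpace Ω]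
    (P : EuclideanSpace ℝ (Fin d) → Measure Ω)
    (X : ℝ≥0 → Ω → EuclideanSpace ℝ (Fin d))
    (f g : EuclideanSpace ℝ (Fin d) → ℝ) : Prop :=
  TendstoUniformly (fun (t : ℝ≥0) x => (transitionOp P X t f x - f x) / (t : ℝ)) g (𝓝[>] 0)

/-- The Fourier transform `(2π)^{-d} ∫ exp(-i⟨ξ,x⟩) f(x) dx`. -/
noncomputable def fourierHat {d : ℕ} (f : EuclideanSpace ℝ (Fin d) → ℝ)
    (ξ : EuclideanSpace ℝ (Fin d)) : ℂ :=
  ((2 * Real.pi : ℝ) : ℂ)⁻¹ ^ d *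
    ∫ x, Complex.exp (-Complex.I * (inner ℝ ξ x : ℝ)) * (f x : ℂ)

/-- `X` is a `d`-dimensional Lévy-type process with symbol `q` and Lévy measure (kernel) `ν`:
a Feller process whose generator has the test functions in its domain and acts on them as the
pseudo-differential operator with symbol `-q`, where `q(x,·)` has a Lévy–Khintchine representation
with Lévy measure `ν(x,·)`, `q` satisfies `|q(x,ξ)| ≤ c (1 + |ξ|²)` uniformly in `x`, and
`q(x,0) = 0`. -/
structure IsLevyTypeProcess {d : ℕ} {Ω : Type*} {mΩ : MeasurableSpace Ω} (ℱ : Filtration ℝ≥0 mΩ)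
    (P : EuclideanSpace ℝ (Fin d) → Measure Ω)
    (X : ℝ≥0 → Ω → EuclideanSpace ℝ (Fin d))
    (q : EuclideanSpace ℝ (Fin d) → EuclideanSpace ℝ (Fin d) → ℂ)
    (ν : Kernel (EuclideanSpace ℝ (Fin d)) (EuclideanSpace ℝ (Fin d))) : Prop
    extends IsFellerProcess ℱ P X where
  testFunctions_subset_domain : ∀ f : EuclideanSpace ℝ (Fin d) → ℝ,
    ContDiff ℝ (⊤ : ℕ∞) f → HasCompactSupport f → ∃ g, HasGeneratorValue P X f g
  generator_eq : ∀ f g : EuclideanSpace ℝ (Fin d) → ℝ,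
    ContDiff ℝ (⊤ : ℕ∞) f → HasCompactSupport f → HasGeneratorValue P X f g →
    ∀ x, (g x : ℂ) =
      -∫ ξ, q x ξ * Complex.exp (Complex.I * (inner ℝ ξ x : ℝ)) * fourierHat f ξ
  isLevyMeasure : ∀ x, IsLevyMeasure (ν x)
  exists_representation : ∃ (a : EuclideanSpace ℝ (Fin d) → ℝ)
    (b : EuclideanSpace ℝ (Fin d) → EuclideanSpace ℝ (Fin d))
    (C : EuclideanSpace ℝ (Fin d) → Matrix (Fin d) (Fin d) ℝ),
    Measurable a ∧ Measurable b ∧ (∀ i j, Measurable fun x => C x i j) ∧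
    (∀ x, 0 ≤ a x) ∧ (∀ x, (C x).PosSemidef) ∧
    ∀ x ξ, q x ξ = levyKhintchine (a x) (b x) (C x) (ν x) ξ
  bounded_coefficients : ∃ c : ℝ, ∀ x ξ, ‖q x ξ‖ ≤ c * (1 + ‖ξ‖ ^ 2)
  symbol_zero : ∀ x, q x 0 = 0

/-! ### Planar notions -/

/-- The rotation of the plane by the angle `φ`. -/
noncomputable def planeRotation (φ : ℝ) (x : EuclideanSpace ℝ (Fin 2)) :
    EuclideanSpace ℝ (Fin 2) :=
  !₂[Real.cos φ * x 0 - Real.sin φ * x 1, Real.sin φ * x 0 + Real.cos φ * x 1]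

/-- A function on the plane is radial if it is invariant under all rotations. (A radial Lévy
exponent satisfies `q(-ξ) = q(ξ)`, hence is real-valued and nonnegative.) -/
def IsRadial (f : EuclideanSpace ℝ (Fin 2) → ℂ) : Prop :=
  ∀ x, ∀ φ ∈ Ico 0 (2 * Real.pi), f (planeRotation φ x) = f x

/-- A symmetric Borel measure `μ` on `ℝ` is quasi-unimodal if, for some `x₀ ≥ 0`, the function
`x ↦ μ(x, ∞)` is (finite and) convex on `(x₀, ∞)`. -/
def IsQuasiUnimodal (μ : Measure ℝ) : Prop :=
  μ.map (fun u => -u) = μ ∧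
    ∃ x₀ : ℝ, 0 ≤ x₀ ∧ (∀ x, x₀ < x → μ (Ioi x) < ∞) ∧
      ConvexOn ℝ (Ioi x₀) fun x => (μ (Ioi x)).toReal

/-- The measure `ν(du × ℝ)` on `ℝ`. -/
noncomputable def firstMarginal (ν : Measure (EuclideanSpace ℝ (Fin 2))) : Measure ℝ :=
  ν.map fun y => y 0

/-- The tails of `ν` dominate those of `ν'`: for some `u₀ ≥ 0`, either
`ν'(B_u(0)ᶜ) ≤ ν(B_u(0)ᶜ)` for all `u ≥ u₀`, or
`ν'((u,∞) × ℝ) ≤ ν((u,∞) × ℝ)` for all `u ≥ u₀`. -/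
def TailsDominate (ν ν' : Measure (EuclideanSpace ℝ (Fin 2))) : Prop :=
  ∃ u₀ : ℝ, 0 ≤ u₀ ∧
    ((∀ u, u₀ ≤ u → ν' (Metric.ball 0 u)ᶜ ≤ ν (Metric.ball 0 u)ᶜ) ∨
      (∀ u, u₀ ≤ u → ν' {y | u < y 0} ≤ ν {y | u < y 0}))

/-- `∫_{B_r(0)} dξ / sup_x |q(x,ξ)| = ∞` for some `r > 0` (with `1/0 = ∞`). -/
def ChungFuchsRecurrence {d : ℕ}
    (q : EuclideanSpace ℝ (Fin d) → EuclideanSpace ℝ (Fin d) → ℂ) : Prop :=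
  ∃ r : ℝ, 0 < r ∧
    ∫⁻ ξ in Metric.ball (0 : EuclideanSpace ℝ (Fin d)) r, (⨆ x, ENNReal.ofReal ‖q x ξ‖)⁻¹ = ∞

/-- `∫_{B_r(0)} dξ / inf_x Re q(x,ξ) < ∞` for some `r > 0` (with `1/0 = ∞`). -/
def ChungFuchsTransience {d : ℕ}
    (q : EuclideanSpace ℝ (Fin d) → EuclideanSpace ℝ (Fin d) → ℂ) : Prop :=
  ∃ r : ℝ, 0 < r ∧
    ∫⁻ ξ in Metric.ball (0 : EuclideanSpace ℝ (Fin d)) r,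
      (⨅ x, ENNReal.ofReal (q x ξ).re)⁻¹ < ∞

/-! The exponents `q(x₀,·)` and `q_L` are real and radial, without killing, and for a radial exponent
`q` in the plane with Lévy measure `ν` there are two-sided bounds: `q(ξ)` is at least a multiple of
`∫ min(1, |ξ|²|y|²) ν(dy)` and at most a multiple of `|ξ|² + ∫ min(1, |ξ|²y₀²) ν(dy)`
(`IsRadialExponent.lintegral_min_norm_le`, `IsRadialExponent.exists_re_le`). The upper bound is
immediate. For the lower bound, `q(ξ + η) ≤ 2 q(ξ) + 2 q(η)`, and in the plane each vector of length
at most `|ξ|` is a sum of two vectors of length `|ξ|`; hence `q` is almost increasing in `|ξ|`, and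
`q(ξ)` dominates its averages over segments of the coordinate axes, where `1 - cos` becomes
`1 - sin s / s`, which is comparable to `min(1, s²)`.

A layer-cake argument (`lintegral_min_le_of_tail_le`) turns domination of tails into an inequality
between these integrals. For the half-plane form of the tail condition one also needs that the first
marginal of a radial exponent's Lévy measure is symmetric (`IsRadialExponent.lintegral_coord_neg`),
which follows from the vanishing of the imaginary part by uniqueness of characteristic functions.
The result is `q' ≤ K (|ξ|² + q)` if `ν` has the heavier tails (`TailsDominate.exists_re_le`), and
the term `|ξ|²` is absorbed by `q` unless `ν = 0`. Radiality thus plays the role that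
quasi-unimodality has for general symmetric exponents.

The corollary then follows from the Chung–Fuchs criterion for `L`: recurrence makes the integral of
`1/q_L` near the origin infinite and transience makes it finite. Both halves test the law of `L_t`
with a suitable function: the squared modulus of the Fourier transform of the indicator of a ball in
the recurrent case, and in the transient case a difference of Gaussians that is positive only near
the origin and has a positive Fourier transform. If `ν_L = 0` in the recurrent part, then
`q(x₀,ξ) ≤ K |ξ|²`, and `1/|ξ|²` is not integrable near the origin of the plane. -/

/-! ### Lévy–Khintchine integrals -/

section LevyKhintchine

variable {d : ℕ} {ν : Measure (EuclideanSpace ℝ (Fin d))}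

theorem measurable_ofReal_min_one_norm_sq :
    Measurable fun y : EuclideanSpace ℝ (Fin d) => ENNReal.ofReal (min 1 (‖y‖ ^ 2)) := by
  fun_prop

theorem IsLevyMeasure.ae_ne_zero (hν : IsLevyMeasure ν) : ∀ᵐ y ∂ν, y ≠ 0 := by
  rw [ae_iff]
  simpa using hν.1

/-- A Lévy measure is s-finite: it has a density with respect to the finite measure
`min(1, |y|²) ν(dy)`. -/
theorem IsLevyMeasure.sFinite (hν : IsLevyMeasure ν) : SFinite ν := by
  set h : EuclideanSpace ℝ (Fin d) → ℝ≥0∞ := fun y => ENNReal.ofReal (min 1 (‖y‖ ^ 2))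
  have : IsFiniteMeasure (ν.withDensity h) := isFiniteMeasure_withDensity hν.2.ne
  have h0 : ∀ᵐ y ∂ν, h y ≠ 0 := by
    filter_upwards [hν.ae_ne_zero] with y hy
    have : 0 < ‖y‖ := norm_pos_iff.2 hy
    simp only [h, ne_eq, ENNReal.ofReal_eq_zero, not_le]
    positivity
  rw [← withDensity_inv_same measurable_ofReal_min_one_norm_sq h0 (by simp)]
  infer_instance

theorem IsLevyMeasure.integrable_min (hν : IsLevyMeasure ν) :
    Integrable (fun y => min 1 (‖y‖ ^ 2)) ν :=
  ⟨by fun_prop, (hasFiniteIntegral_iff_ofReal (ae_of_all _ fun y => by positivity)).2 hν.2⟩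

theorem IsLevyMeasure.eq_zero_of_lintegral_min_eq_zero (hν : IsLevyMeasure ν)
    (h : ∫⁻ y, ENNReal.ofReal (min 1 (‖y‖ ^ 2)) ∂ν = 0) : ν = 0 := by
  rw [lintegral_eq_zero_iff measurable_ofReal_min_one_norm_sq] at h
  refine ae_eq_bot.1 (eventually_false_iff_eq_bot.1 ?_)
  filter_upwards [h, hν.ae_ne_zero] with y hy hy0
  have : 0 < ‖y‖ := norm_pos_iff.2 hy0
  have h1 : (0 : ℝ) < min 1 (‖y‖ ^ 2) := by positivity
  simp only [Pi.zero_apply, ENNReal.ofReal_eq_zero] at hy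
  exact absurd hy (not_le.2 h1)

theorem norm_one_sub_exp_add_le (s : ℝ) :
    ‖1 - Complex.exp (Complex.I * (s : ℝ)) + Complex.I * (s : ℝ)‖ ≤ 3 * s ^ 2 := by
  rcases le_or_gt |s| 1 with hs | hs
  · have h := Complex.norm_exp_sub_one_sub_id_le (x := Complex.I * (s : ℝ)) (by simpa using hs)
    rw [← norm_neg]
    have e : -(1 - Complex.exp (Complex.I * (s : ℝ)) + Complex.I * (s : ℝ))
      = Complex.exp (Complex.I * (s : ℝ)) - 1 - Complex.I * (s : ℝ) := by ring
    rw [e]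
    refine h.trans ?_
    simp only [norm_mul, Complex.norm_I, one_mul, Complex.norm_real, Real.norm_eq_abs, sq_abs]
    nlinarith [sq_nonneg s]
  · have h1 : ‖1 - Complex.exp (Complex.I * (s : ℝ)) + Complex.I * (s : ℝ)‖ ≤ |s| + |s| := by
      refine (norm_add_le _ _).trans (add_le_add ?_ (by simp))
      rw [← norm_neg, neg_sub]
      exact Real.norm_exp_I_mul_ofReal_sub_one_le
    rw [← sq_abs s]
    nlinarith

theorem measurable_levyKhintchine_integrand (ξ : EuclideanSpace ℝ (Fin d)) :
    Measurable fun y : EuclideanSpace ℝ (Fin d) =>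
      (1 - Complex.exp (Complex.I * (inner ℝ ξ y : ℝ))
        + (Metric.ball (0 : EuclideanSpace ℝ (Fin d)) 1).indicator
            (fun y => Complex.I * (inner ℝ ξ y : ℝ)) y) := by
  refine Measurable.add ?_ (Measurable.indicator ?_ measurableSet_ball) <;> fun_prop

theorem IsLevyMeasure.integrable_levyKhintchine (hν : IsLevyMeasure ν)
    (ξ : EuclideanSpace ℝ (Fin d)) :
    Integrable (fun y => (1 - Complex.exp (Complex.I * (inner ℝ ξ y : ℝ))
        + (Metric.ball (0 : EuclideanSpace ℝ (Fin d)) 1).indicator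
            (fun y => Complex.I * (inner ℝ ξ y : ℝ)) y)) ν := by
  refine Integrable.mono' (hν.integrable_min.const_mul (2 + 3 * ‖ξ‖ ^ 2))
    (measurable_levyKhintchine_integrand ξ).aestronglyMeasurable (ae_of_all _ fun y => ?_)
  by_cases hy : y ∈ Metric.ball (0 : EuclideanSpace ℝ (Fin d)) 1
  · rw [indicator_of_mem hy]
    have hy1 : ‖y‖ < 1 := by simpa using hy
    have h1 : ‖y‖ ^ 2 ≤ 1 := pow_le_one₀ (norm_nonneg y) hy1.le
    rw [min_eq_right h1]
    refine (norm_one_sub_exp_add_le _).trans ?_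
    have h2 : (inner ℝ ξ y) ^ 2 ≤ (‖ξ‖ * ‖y‖) ^ 2 := sq_le_sq' (neg_le_of_abs_le
      (abs_real_inner_le_norm ξ y)) (le_of_abs_le (abs_real_inner_le_norm ξ y))
    nlinarith [sq_nonneg ‖y‖]
  · rw [indicator_of_notMem hy, add_zero]
    have hy1 : 1 ≤ ‖y‖ := by simpa using hy
    rw [min_eq_left (one_le_pow₀ hy1), mul_one]
    refine (norm_sub_le _ _).trans ?_
    rw [mul_comm, Complex.norm_exp_ofReal_mul_I, norm_one]
    nlinarith [sq_nonneg ‖ξ‖]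

theorem IsLevyMeasure.re_levyKhintchine (hν : IsLevyMeasure ν) (a : ℝ)
    (b : EuclideanSpace ℝ (Fin d)) (C : Matrix (Fin d) (Fin d) ℝ) (ξ : EuclideanSpace ℝ (Fin d)) :
    (levyKhintchine a b C ν ξ).re = a + 1 / 2 * (∑ i, ∑ j, ξ i * C i j * ξ j)
      + ∫ y, (1 - Real.cos (inner ℝ ξ y)) ∂ν := by
  have h := integral_re (hν.integrable_levyKhintchine ξ)
  simp only [RCLike.re_to_complex] at h
  rw [levyKhintchine, Complex.add_re, ← h]
  congr 1
  · rw [show (1 / 2 : ℂ) = ((1 / 2 : ℝ) : ℂ) by norm_num, ← Complex.ofReal_mul]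
    simp
  · congr 1 with y
    rw [mul_comm Complex.I, Complex.add_re, Complex.sub_re, Complex.exp_ofReal_mul_I_re]
    by_cases hy : y ∈ Metric.ball (0 : EuclideanSpace ℝ (Fin d)) 1
    · rw [indicator_of_mem hy]; simp
    · rw [indicator_of_notMem hy]; simp

theorem IsLevyMeasure.im_levyKhintchine (hν : IsLevyMeasure ν) (a : ℝ)
    (b : EuclideanSpace ℝ (Fin d)) (C : Matrix (Fin d) (Fin d) ℝ) (ξ : EuclideanSpace ℝ (Fin d)) :
    (levyKhintchine a b C ν ξ).im = -inner ℝ ξ b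
      + ∫ y, ((Metric.ball (0 : EuclideanSpace ℝ (Fin d)) 1).indicator
            (fun y => inner ℝ ξ y) y - Real.sin (inner ℝ ξ y)) ∂ν := by
  have h := integral_im (hν.integrable_levyKhintchine ξ)
  simp only [RCLike.im_to_complex] at h
  rw [levyKhintchine, Complex.add_im, ← h]
  congr 1
  · rw [show (1 / 2 : ℂ) = ((1 / 2 : ℝ) : ℂ) by norm_num, ← Complex.ofReal_mul]
    simp
  · congr 1 with y
    rw [mul_comm Complex.I, Complex.add_im, Complex.sub_im, Complex.exp_ofReal_mul_I_im]
    by_cases hy : y ∈ Metric.ball (0 : EuclideanSpace ℝ (Fin d)) 1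
    · simp only [indicator_of_mem hy]; simp; ring
    · simp only [indicator_of_notMem hy]; simp

theorem IsLevyMeasure.integrable_indicator_inner_sub_sin (hν : IsLevyMeasure ν)
    (ξ : EuclideanSpace ℝ (Fin d)) :
    Integrable (fun y => (Metric.ball (0 : EuclideanSpace ℝ (Fin d)) 1).indicator
            (fun y => inner ℝ ξ y) y - Real.sin (inner ℝ ξ y)) ν := by
  refine (hν.integrable_levyKhintchine ξ).im.congr (ae_of_all _ fun y => ?_)
  simp only [RCLike.im_to_complex]
  rw [mul_comm Complex.I, Complex.add_im, Complex.sub_im, Complex.exp_ofReal_mul_I_im]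
  by_cases hy : y ∈ Metric.ball (0 : EuclideanSpace ℝ (Fin d)) 1
  · simp only [indicator_of_mem hy]; simp; ring
  · simp only [indicator_of_notMem hy]; simp

theorem IsLevyMeasure.integrable_one_sub_cos (hν : IsLevyMeasure ν)
    (ξ : EuclideanSpace ℝ (Fin d)) :
    Integrable (fun y => 1 - Real.cos (inner ℝ ξ y)) ν := by
  refine (hν.integrable_levyKhintchine ξ).re.congr (ae_of_all _ fun y => ?_)
  simp only [RCLike.re_to_complex]
  rw [mul_comm Complex.I, Complex.add_re, Complex.sub_re, Complex.exp_ofReal_mul_I_re]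
  by_cases hy : y ∈ Metric.ball (0 : EuclideanSpace ℝ (Fin d)) 1
  · rw [indicator_of_mem hy]; simp
  · rw [indicator_of_notMem hy]; simp

end LevyKhintchine

/-! ### Radial Lévy exponents in the plane -/

/-- `q` is the characteristic exponent, without killing, of a planar Lévy process with Lévy
measure `ν`, and is invariant under rotations. -/
structure IsRadialExponent (q : EuclideanSpace ℝ (Fin 2) → ℂ)
    (ν : Measure (EuclideanSpace ℝ (Fin 2))) : Prop where
  radial : IsRadial q
  levy : IsLevyMeasure ν
  rep : ∃ (b : EuclideanSpace ℝ (Fin 2)) (C : Matrix (Fin 2) (Fin 2) ℝ),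
    C.PosSemidef ∧ ∀ ξ, q ξ = levyKhintchine 0 b C ν ξ

theorem exists_polar (x : EuclideanSpace ℝ (Fin 2)) :
    ∃ φ ∈ Ico 0 (2 * Real.pi), planeRotation φ !₂[‖x‖, 0] = x := by
  set z : ℂ := ⟨x 0, x 1⟩ with hz
  have hn : ‖z‖ = ‖x‖ := by
    rw [EuclideanSpace.norm_eq, Complex.norm_eq_sqrt_sq_add_sq]
    simp [Fin.sum_univ_two, hz]
  have hc : ‖x‖ * Real.cos z.arg = x 0 := by rw [← hn, Complex.norm_mul_cos_arg]
  have hs : ‖x‖ * Real.sin z.arg = x 1 := by rw [← hn, Complex.norm_mul_sin_arg]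
  have key : ∀ φ : ℝ, Real.cos φ = Real.cos z.arg → Real.sin φ = Real.sin z.arg →
      planeRotation φ !₂[‖x‖, 0] = x := by
    intro φ h1 h2
    ext i
    fin_cases i <;> simp [planeRotation, h1, h2, ← hc, ← hs, mul_comm]
  rcases le_or_gt 0 z.arg with h | h
  · exact ⟨z.arg, ⟨h, by linarith [Complex.arg_le_pi z, Real.pi_pos]⟩, key _ rfl rfl⟩
  · exact ⟨z.arg + 2 * Real.pi, ⟨by linarith [Complex.neg_pi_lt_arg z, Real.pi_pos], by linarith⟩,
      key _ (Real.cos_add_two_pi _) (Real.sin_add_two_pi _)⟩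

theorem IsRadial.eq_of_norm_eq {f : EuclideanSpace ℝ (Fin 2) → ℂ} (hf : IsRadial f)
    {x y : EuclideanSpace ℝ (Fin 2)} (h : ‖x‖ = ‖y‖) : f x = f y := by
  obtain ⟨φ, hφ, hx⟩ := exists_polar x
  obtain ⟨ψ, hψ, hy⟩ := exists_polar y
  rw [← hx, ← hy, hf _ _ hφ, hf _ _ hψ, h]

namespace IsRadialExponent

variable {q : EuclideanSpace ℝ (Fin 2) → ℂ} {ν : Measure (EuclideanSpace ℝ (Fin 2))}

/-- The imaginary part of a Lévy–Khintchine exponent is odd, that of a radial function is even. -/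
theorem im_eq_zero (h : IsRadialExponent q ν) (ξ : EuclideanSpace ℝ (Fin 2)) : (q ξ).im = 0 := by
  obtain ⟨b, C, -, hq⟩ := h.rep
  have h1 : (q (-ξ)).im = -(q ξ).im := by
    rw [hq, hq, h.levy.im_levyKhintchine, h.levy.im_levyKhintchine, neg_add, ← integral_neg]
    congr 1
    · simp
    · congr 1 with y
      by_cases hy : y ∈ Metric.ball (0 : EuclideanSpace ℝ (Fin 2)) 1
      · simp only [indicator_of_mem hy, inner_neg_left, Real.sin_neg]; ring
      · simp only [indicator_of_notMem hy, inner_neg_left, Real.sin_neg]; ring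
  rw [h.radial.eq_of_norm_eq (norm_neg ξ)] at h1
  linarith

theorem coe_re (h : IsRadialExponent q ν) (ξ : EuclideanSpace ℝ (Fin 2)) :
    (((q ξ).re : ℝ) : ℂ) = q ξ :=
  Complex.ext (by simp) (by simp [h.im_eq_zero ξ])

/-- The real form of the exponent: a nonnegative quadratic form and the integral of
`1 - cos⟨ξ,y⟩`. -/
theorem exists_re_eq (h : IsRadialExponent q ν) :
    ∃ C : Matrix (Fin 2) (Fin 2) ℝ,
      (∀ ξ : EuclideanSpace ℝ (Fin 2), 0 ≤ ∑ i, ∑ j, ξ i * C i j * ξ j) ∧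
      ∀ ξ, (q ξ).re = 1 / 2 * (∑ i, ∑ j, ξ i * C i j * ξ j)
        + ∫ y, (1 - Real.cos (inner ℝ ξ y)) ∂ν := by
  obtain ⟨b, C, hC, hq⟩ := h.rep
  refine ⟨C, fun ξ => ?_, fun ξ => ?_⟩
  · have := hC.dotProduct_mulVec_nonneg ξ
    simpa [dotProduct, Matrix.mulVec, Fin.sum_univ_two, mul_add, mul_assoc] using this
  · rw [hq, h.levy.re_levyKhintchine, zero_add]

theorem integral_one_sub_cos_le (h : IsRadialExponent q ν) (ξ : EuclideanSpace ℝ (Fin 2)) :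
    ∫ y, (1 - Real.cos (inner ℝ ξ y)) ∂ν ≤ (q ξ).re := by
  obtain ⟨C, hC, hq⟩ := h.exists_re_eq
  rw [hq]
  linarith [hC ξ]

theorem re_nonneg (h : IsRadialExponent q ν) (ξ : EuclideanSpace ℝ (Fin 2)) : 0 ≤ (q ξ).re :=
  le_trans (integral_nonneg fun y => by simpa using Real.cos_le_one _)
    (h.integral_one_sub_cos_le ξ)

theorem lintegral_one_sub_cos_le (h : IsRadialExponent q ν) (ξ : EuclideanSpace ℝ (Fin 2)) :
    ∫⁻ y, ENNReal.ofReal (1 - Real.cos (inner ℝ ξ y)) ∂ν ≤ ENNReal.ofReal (q ξ).re := by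
  rw [← ofReal_integral_eq_lintegral_ofReal (h.levy.integrable_one_sub_cos ξ)
    (ae_of_all _ fun y => by simpa using Real.cos_le_one _)]
  exact ENNReal.ofReal_le_ofReal (h.integral_one_sub_cos_le ξ)

theorem re_add_le (h : IsRadialExponent q ν) (ξ η : EuclideanSpace ℝ (Fin 2)) :
    (q (ξ + η)).re ≤ 2 * (q ξ).re + 2 * (q η).re := by
  obtain ⟨C, hC, hq⟩ := h.exists_re_eq
  have h1 := hC (ξ - η)
  have h2 : ∫ y, (1 - Real.cos (inner ℝ (ξ + η) y)) ∂ν ≤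
      2 * ∫ y, (1 - Real.cos (inner ℝ ξ y)) ∂ν + 2 * ∫ y, (1 - Real.cos (inner ℝ η y)) ∂ν := by
    rw [← integral_const_mul, ← integral_const_mul, ← integral_add
      ((h.levy.integrable_one_sub_cos ξ).const_mul 2)
      ((h.levy.integrable_one_sub_cos η).const_mul 2)]
    refine integral_mono (h.levy.integrable_one_sub_cos _)
      (((h.levy.integrable_one_sub_cos ξ).const_mul 2).add
      ((h.levy.integrable_one_sub_cos η).const_mul 2)) fun y => ?_
    simp only [inner_add_left, Real.cos_add]
    generalize inner ℝ ξ y = s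
    generalize inner ℝ η y = t
    nlinarith [sq_nonneg (Real.sin s - Real.sin t), Real.sin_sq_add_cos_sq s,
      Real.sin_sq_add_cos_sq t, Real.cos_le_one s, Real.cos_le_one t,
      sq_nonneg (Real.cos s + Real.cos t - 2)]
  rw [hq, hq, hq]
  simp only [Fin.sum_univ_two, PiLp.add_apply, PiLp.sub_apply] at h1 ⊢
  nlinarith

/-- A radial exponent is almost increasing in `‖ξ‖`, because a shorter vector is the sum of two
vectors of length `‖ξ‖`. -/
theorem re_le_of_norm_le (h : IsRadialExponent q ν) {ξ η : EuclideanSpace ℝ (Fin 2)}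
    (hle : ‖η‖ ≤ ‖ξ‖) : (q η).re ≤ 4 * (q ξ).re := by
  set a : ℝ := ‖η‖ / 2
  set c : ℝ := Real.sqrt (‖ξ‖ ^ 2 - a ^ 2)
  have hc : c ^ 2 = ‖ξ‖ ^ 2 - a ^ 2 := Real.sq_sqrt (by
    have : a ≤ ‖ξ‖ := by simp only [a]; linarith [norm_nonneg η]
    have ha : 0 ≤ a := by positivity
    nlinarith)
  have hn : ∀ e : ℝ, e ^ 2 = c ^ 2 → ‖(!₂[a, e] : EuclideanSpace ℝ (Fin 2))‖ = ‖ξ‖ := by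
    intro e he
    rw [EuclideanSpace.norm_eq, ← Real.sqrt_sq (norm_nonneg ξ)]
    congr 1
    simp [Fin.sum_univ_two, he, hc]
  have h0 : ‖(!₂[a, c] + !₂[a, -c] : EuclideanSpace ℝ (Fin 2))‖ = ‖η‖ := by
    rw [EuclideanSpace.norm_eq, ← Real.sqrt_sq (norm_nonneg η)]
    congr 1
    simp [Fin.sum_univ_two, a]
  have := h.re_add_le !₂[a, c] !₂[a, -c]
  rw [h.radial.eq_of_norm_eq h0, h.radial.eq_of_norm_eq (hn c rfl),
    h.radial.eq_of_norm_eq (hn (-c) (by ring))] at this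
  linarith

end IsRadialExponent

/-! ### Two-sided bounds for radial exponents -/

/-- The average of `1 - cos` over `[0, s]` is `1 - sin s / s`: for `|s| ≤ π` it is bounded below by
a quadratic bound on the cosine, for `|s| > π` because `|sin s / s| ≤ 1/3`. -/
theorem min_one_sq_le_integral_one_sub_cos (s : ℝ) :
    min 1 (s ^ 2) ≤ 20 * ∫ τ in (0 : ℝ)..1, (1 - Real.cos (τ * s)) := by
  rcases le_or_gt |s| Real.pi with hs | hs
  · have h1 : ∫ τ in (0 : ℝ)..1, s ^ 2 / 5 * τ ^ 2 ≤ ∫ τ in (0 : ℝ)..1, (1 - Real.cos (τ * s)) := by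
      refine intervalIntegral.integral_mono_on zero_le_one
        (by apply Continuous.intervalIntegrable; fun_prop)
        (by apply Continuous.intervalIntegrable; fun_prop) fun τ hτ => ?_
      have h2 : |τ * s| ≤ Real.pi := by
        rw [abs_mul, abs_of_nonneg hτ.1]
        exact (mul_le_of_le_one_left (abs_nonneg s) hτ.2).trans hs
      have h3 := Real.cos_le_one_sub_mul_cos_sq h2
      have h4 : (1 / 5 : ℝ) ≤ 2 / Real.pi ^ 2 := by
        rw [div_le_div_iff₀ (by norm_num) (by positivity)]
        nlinarith [Real.pi_lt_d2, Real.pi_pos]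
      nlinarith [mul_le_mul_of_nonneg_right h4 (sq_nonneg (τ * s))]
    rw [intervalIntegral.integral_const_mul, integral_pow] at h1
    refine (min_le_right _ _).trans ?_
    norm_num at h1
    nlinarith [sq_nonneg s]
  · have hs0 : s ≠ 0 := by
      rintro rfl
      simp at hs
      linarith [Real.pi_pos]
    have h1 : ∫ τ in (0 : ℝ)..1, (1 - Real.cos (τ * s)) = 1 - s⁻¹ * Real.sin s := by
      rw [intervalIntegral.integral_sub (by simp)
        (by apply Continuous.intervalIntegrable; fun_prop),
        intervalIntegral.integral_comp_mul_right _ hs0]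
      simp
    have h2 : s⁻¹ * Real.sin s ≤ 1 / 3 := by
      refine (le_abs_self _).trans ?_
      rw [abs_mul, abs_inv, inv_mul_le_iff₀ (abs_pos.2 hs0)]
      linarith [Real.abs_sin_le_one s, Real.pi_gt_three]
    rw [h1]
    linarith [min_le_left 1 (s ^ 2)]

theorem ofReal_min_one_sq_le_lintegral (s : ℝ) :
    ENNReal.ofReal (min 1 (s ^ 2)) ≤
      20 * ∫⁻ τ in Ioc (0 : ℝ) 1, ENNReal.ofReal (1 - Real.cos (τ * s)) := by
  have hi : Integrable (fun τ : ℝ => 1 - Real.cos (τ * s)) (volume.restrict (Ioc 0 1)) :=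
    (Continuous.integrableOn_Icc (by fun_prop)).mono_set Ioc_subset_Icc_self
  rw [← ofReal_integral_eq_lintegral_ofReal hi
    (ae_of_all _ fun τ => by simpa using Real.cos_le_one _),
    ← intervalIntegral.integral_of_le zero_le_one]
  rw [show (20 : ℝ≥0∞) = ENNReal.ofReal 20 by simp, ← ENNReal.ofReal_mul (by norm_num)]
  exact ENNReal.ofReal_le_ofReal (min_one_sq_le_integral_one_sub_cos s)

theorem inner_single_left (i : Fin 2) (c : ℝ) (y : EuclideanSpace ℝ (Fin 2)) :
    inner ℝ (EuclideanSpace.single i c) y = c * y i := by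
  rw [EuclideanSpace.inner_single_left, conj_trivial]

theorem one_sub_cos_le_two_mul_min (s : ℝ) : 1 - Real.cos s ≤ 2 * min 1 (s ^ 2) := by
  rw [mul_min_of_nonneg _ _ zero_le_two, le_min_iff]
  constructor
  · linarith [Real.neg_one_le_cos s]
  · nlinarith [Real.one_sub_sq_div_two_le_cos (x := s), sq_nonneg s]

theorem ofReal_one_sub_cos_le (s : ℝ) :
    ENNReal.ofReal (1 - Real.cos s) ≤ 2 * ENNReal.ofReal (min 1 (s ^ 2)) := by
  rw [← ENNReal.ofReal_ofNat 2, ← ENNReal.ofReal_mul (by norm_num)]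
  exact ENNReal.ofReal_le_ofReal (one_sub_cos_le_two_mul_min s)

/-- The two cosines are never both `1` away from `0`, because `√2` is irrational. -/
theorem two_sub_cos_sub_cos_sqrt_two_pos {s : ℝ} (hs : s ≠ 0) :
    0 < (1 - Real.cos s) + (1 - Real.cos (√2 * s)) := by
  have h1 := Real.cos_le_one s
  have h2 := Real.cos_le_one (√2 * s)
  by_contra! hle
  obtain ⟨m, hm⟩ := (Real.cos_eq_one_iff s).1 (by linarith)
  obtain ⟨n, hn⟩ := (Real.cos_eq_one_iff _).1 (show Real.cos (√2 * s) = 1 by linarith)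
  have hpi := Real.pi_pos
  have hm0 : m ≠ 0 := by
    rintro rfl
    simp at hm
    exact hs hm.symm
  refine irrational_sqrt_two.ne_rat (n / m : ℚ) ?_
  push_cast
  rw [eq_div_iff (by exact_mod_cast hm0)]
  rw [← hm] at hn
  have h3 : (2 * Real.pi) * (√2 * m) = (2 * Real.pi) * n := by linarith
  exact mul_left_cancel₀ (by positivity) h3

namespace IsRadialExponent

variable {q : EuclideanSpace ℝ (Fin 2) → ℂ} {ν : Measure (EuclideanSpace ℝ (Fin 2))}

/-- The lower bound for a radial exponent, obtained by averaging it over the segments from `0`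
to `‖ξ‖` on the coordinate axes. -/
theorem lintegral_min_coord_le (h : IsRadialExponent q ν) (i : Fin 2)
    (ξ : EuclideanSpace ℝ (Fin 2)) :
    ∫⁻ y, ENNReal.ofReal (min 1 ((‖ξ‖ * y i) ^ 2)) ∂ν ≤ 80 * ENNReal.ofReal (q ξ).re := by
  have := h.levy.sFinite
  calc ∫⁻ y, ENNReal.ofReal (min 1 ((‖ξ‖ * y i) ^ 2)) ∂ν
      ≤ ∫⁻ y, (20 * ∫⁻ τ in Ioc (0 : ℝ) 1,
          ENNReal.ofReal (1 - Real.cos (τ * (‖ξ‖ * y i)))) ∂ν :=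
        lintegral_mono fun y => ofReal_min_one_sq_le_lintegral _
    _ = 20 * ∫⁻ τ in Ioc (0 : ℝ) 1, ∫⁻ y,
          ENNReal.ofReal (1 - Real.cos (τ * (‖ξ‖ * y i))) ∂ν := by
        rw [lintegral_const_mul' _ _ (by simp), lintegral_lintegral_swap]
        apply Measurable.aemeasurable
        fun_prop
    _ ≤ 20 * ∫⁻ τ in Ioc (0 : ℝ) 1, 4 * ENNReal.ofReal (q ξ).re := by
        refine mul_le_mul_right ?_ _
        refine setLIntegral_mono measurable_const fun τ hτ => ?_
        have h1 := h.lintegral_one_sub_cos_le (EuclideanSpace.single i (τ * ‖ξ‖))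
        simp only [inner_single_left, mul_assoc] at h1
        refine h1.trans ?_
        rw [show (4 : ℝ≥0∞) = ENNReal.ofReal 4 by simp, ← ENNReal.ofReal_mul (by norm_num)]
        refine ENNReal.ofReal_le_ofReal (h.re_le_of_norm_le ?_)
        rw [PiLp.norm_single, norm_mul, norm_norm, Real.norm_of_nonneg hτ.1.le]
        exact mul_le_of_le_one_left (norm_nonneg _) hτ.2
    _ = 80 * ENNReal.ofReal (q ξ).re := by
        simp [← mul_assoc]
        norm_num

theorem lintegral_min_norm_le (h : IsRadialExponent q ν) (ξ : EuclideanSpace ℝ (Fin 2)) :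
    ∫⁻ y, ENNReal.ofReal (min 1 ((‖ξ‖ * ‖y‖) ^ 2)) ∂ν ≤ 160 * ENNReal.ofReal (q ξ).re := by
  calc ∫⁻ y, ENNReal.ofReal (min 1 ((‖ξ‖ * ‖y‖) ^ 2)) ∂ν
      ≤ ∫⁻ y, (ENNReal.ofReal (min 1 ((‖ξ‖ * y 0) ^ 2))
          + ENNReal.ofReal (min 1 ((‖ξ‖ * y 1) ^ 2))) ∂ν := by
        refine lintegral_mono fun y => ?_
        rw [← ENNReal.ofReal_add (by positivity) (by positivity)]
        refine ENNReal.ofReal_le_ofReal ?_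
        have hy : ‖y‖ ^ 2 = y 0 ^ 2 + y 1 ^ 2 := by
          rw [EuclideanSpace.norm_sq_eq]
          simp [Fin.sum_univ_two]
        rw [mul_pow, hy, mul_add, ← mul_pow, ← mul_pow]
        have ha := sq_nonneg (‖ξ‖ * y 0)
        have hb := sq_nonneg (‖ξ‖ * y 1)
        simp only [min_def]
        split_ifs <;> linarith
    _ ≤ 80 * ENNReal.ofReal (q ξ).re + 80 * ENNReal.ofReal (q ξ).re := by
        rw [lintegral_add_left (by fun_prop)]
        exact add_le_add (h.lintegral_min_coord_le 0 ξ) (h.lintegral_min_coord_le 1 ξ)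
    _ = 160 * ENNReal.ofReal (q ξ).re := by
        rw [← add_mul]
        norm_num

theorem exists_re_le (h : IsRadialExponent q ν) :
    ∃ K : ℝ, 0 ≤ K ∧ ∀ ξ, ENNReal.ofReal (q ξ).re ≤ ENNReal.ofReal (K * ‖ξ‖ ^ 2)
      + 2 * ∫⁻ y, ENNReal.ofReal (min 1 ((‖ξ‖ * y 0) ^ 2)) ∂ν := by
  obtain ⟨C, hC, hq⟩ := h.exists_re_eq
  refine ⟨|C 0 0|, abs_nonneg _, fun ξ => ?_⟩
  rw [h.radial.eq_of_norm_eq (y := EuclideanSpace.single 0 ‖ξ‖) (by simp), hq]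
  refine ENNReal.ofReal_add_le.trans (add_le_add (ENNReal.ofReal_le_ofReal ?_) ?_)
  · simp
    nlinarith [le_abs_self (C 0 0), abs_nonneg (C 0 0), sq_nonneg ‖ξ‖,
      mul_le_mul_of_nonneg_left (le_abs_self (C 0 0)) (sq_nonneg ‖ξ‖)]
  · rw [ofReal_integral_eq_lintegral_ofReal (h.levy.integrable_one_sub_cos _)
      (ae_of_all _ fun y => by simpa using Real.cos_le_one _), ← lintegral_const_mul' _ _ (by simp)]
    refine lintegral_mono fun y => ?_
    rw [inner_single_left]
    exact ofReal_one_sub_cos_le (‖ξ‖ * y 0)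

/-- A radial exponent with nonzero Lévy measure is at least of order `‖ξ‖²` near the origin. -/
theorem exists_norm_sq_le (h : IsRadialExponent q ν)
    (hν : ∫⁻ y, ENNReal.ofReal (min 1 (‖y‖ ^ 2)) ∂ν ≠ 0) :
    ∃ K : ℝ, 0 < K ∧ ∀ ξ, ‖ξ‖ ≤ 1 → ‖ξ‖ ^ 2 ≤ K * (q ξ).re := by
  set m : ℝ := (∫⁻ y, ENNReal.ofReal (min 1 (‖y‖ ^ 2)) ∂ν).toReal with hm
  have hm0 : 0 < m := ENNReal.toReal_pos hν h.levy.2.ne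
  refine ⟨160 / m, by positivity, fun ξ hξ => ?_⟩
  have h1 : ENNReal.ofReal (‖ξ‖ ^ 2 * m) ≤ ENNReal.ofReal (160 * (q ξ).re) := by
    rw [ENNReal.ofReal_mul (by positivity), hm, ENNReal.ofReal_toReal h.levy.2.ne,
      ENNReal.ofReal_mul (by norm_num), show ENNReal.ofReal 160 = 160 by simp]
    refine le_trans ?_ (h.lintegral_min_norm_le ξ)
    rw [← lintegral_const_mul' _ _ (by simp)]
    refine lintegral_mono fun y => ?_
    rw [← ENNReal.ofReal_mul (by positivity)]
    refine ENNReal.ofReal_le_ofReal ?_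
    have hx : ‖ξ‖ ^ 2 ≤ 1 := pow_le_one₀ (norm_nonneg _) hξ
    rw [mul_pow, le_min_iff]
    exact ⟨mul_le_one₀ hx (by positivity) (min_le_left _ _),
      mul_le_mul_of_nonneg_left (min_le_right _ _) (sq_nonneg _)⟩
  rw [ENNReal.ofReal_le_ofReal_iff (mul_nonneg (by norm_num) (h.re_nonneg ξ))] at h1
  rw [div_mul_eq_mul_div, le_div_iff₀ hm0]
  exact h1

/-! ### Symmetry of the first marginal of the Lévy measure -/

theorem integral_sin_mul_one_sub_cos (h : IsRadialExponent q ν)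
    (ξ w : EuclideanSpace ℝ (Fin 2)) :
    ∫ y, Real.sin (inner ℝ ξ y) * (1 - Real.cos (inner ℝ w y)) ∂ν = 0 := by
  obtain ⟨b, C, -, hq⟩ := h.rep
  set J : EuclideanSpace ℝ (Fin 2) → EuclideanSpace ℝ (Fin 2) → ℝ := fun ξ y =>
    (Metric.ball (0 : EuclideanSpace ℝ (Fin 2)) 1).indicator
            (fun y => inner ℝ ξ y) y - Real.sin (inner ℝ ξ y) with hJ
  have hJi : ∀ η, Integrable (J η) ν := h.levy.integrable_indicator_inner_sub_sin
  have h0 : ∀ η, ∫ y, J η y ∂ν = inner ℝ η b := fun η => by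
    have := h.im_eq_zero η
    rw [hq, h.levy.im_levyKhintchine] at this
    linarith
  have h1 : ∫ y, (J (ξ + w) y + J (ξ - w) y - 2 * J ξ y) ∂ν = 0 := by
    rw [integral_sub (f := fun y => J (ξ + w) y + J (ξ - w) y) ((hJi _).add (hJi _))
      ((hJi _).const_mul 2), integral_add (hJi _) (hJi _),
      integral_const_mul, h0, h0, h0, inner_add_left, inner_sub_left]
    ring
  have h2 : ∀ y, J (ξ + w) y + J (ξ - w) y - 2 * J ξ y
      = 2 * (Real.sin (inner ℝ ξ y) * (1 - Real.cos (inner ℝ w y))) := fun y => by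
    by_cases hy : y ∈ Metric.ball (0 : EuclideanSpace ℝ (Fin 2)) 1
    · simp only [hJ, indicator_of_mem hy, inner_add_left, inner_sub_left, Real.sin_add,
        Real.sin_sub]
      ring
    · simp only [hJ, indicator_of_notMem hy, inner_add_left, inner_sub_left, Real.sin_add,
        Real.sin_sub]
      ring
  simp only [h2, integral_const_mul] at h1
  linarith

/-- The first coordinate is symmetric under the Lévy measure of a radial exponent. The finite
measure with density `2 - cos y₀ - cos (√2 y₀)` has a real characteristic function, so it is
symmetric; the density is even and vanishes only on `y₀ = 0`. -/
theorem lintegral_coord_neg (h : IsRadialExponent q ν) {g : ℝ → ℝ≥0∞} (hg : Measurable g)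
    (hg0 : g 0 = 0) : ∫⁻ y, g (-y 0) ∂ν = ∫⁻ y, g (y 0) ∂ν := by
  set k : EuclideanSpace ℝ (Fin 2) → ℝ :=
    fun y => (1 - Real.cos (y 0)) + (1 - Real.cos (√2 * y 0)) with hk
  have hk0 : ∀ y, 0 ≤ k y := fun y => by
    simp only [hk]
    linarith [Real.cos_le_one (y 0), Real.cos_le_one (√2 * y 0)]
  have hkm : Measurable k := by fun_prop
  have hcos : ∀ c : ℝ, Integrable (fun y : EuclideanSpace ℝ (Fin 2) =>
      1 - Real.cos (c * y 0)) ν := fun c => by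
    simpa only [inner_single_left] using
      h.levy.integrable_one_sub_cos (EuclideanSpace.single 0 c)
  have hki : Integrable k ν := ((hcos 1).add (hcos (√2))).congr
    (ae_of_all _ fun y => by simp [hk])
  set ρ := ν.withDensity fun y => ENNReal.ofReal (k y) with hρ
  have hfin : IsFiniteMeasure ρ := isFiniteMeasure_withDensity
    ((hasFiniteIntegral_iff_ofReal (ae_of_all _ hk0)).1 hki.2).ne
  have hsin : ∀ (ξ : EuclideanSpace ℝ (Fin 2)) (c : ℝ),
      ∫ y, Real.sin (inner ℝ ξ y) * (1 - Real.cos (c * y 0)) ∂ν = 0 := fun ξ c => by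
    simpa only [inner_single_left] using
      h.integral_sin_mul_one_sub_cos ξ (EuclideanSpace.single 0 c)
  have hsini : ∀ (ξ : EuclideanSpace ℝ (Fin 2)) (c : ℝ), Integrable (fun y =>
      Real.sin (inner ℝ ξ y) * (1 - Real.cos (c * y 0))) ν := fun ξ c =>
    (hcos c).bdd_mul (c := 1) (by fun_prop) (ae_of_all _ fun y => Real.abs_sin_le_one _)
  have him : ∀ ξ, (charFun ρ ξ).im = 0 := fun ξ => by
    have hint : Integrable (fun x => Complex.exp ((inner ℝ x ξ : ℝ) * Complex.I)) ρ :=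
      Integrable.of_bound (C := 1) (by fun_prop) (ae_of_all _ fun y => by
        rw [Complex.norm_exp_ofReal_mul_I])
    have h1 := integral_im hint
    simp only [RCLike.im_to_complex, Complex.exp_ofReal_mul_I_im] at h1
    rw [charFun_apply, ← h1, hρ, integral_withDensity_eq_integral_toReal_smul (by fun_prop)
      (by simp)]
    have h2 := integral_add (hsini ξ 1) (hsini ξ (√2))
    rw [hsin, hsin, add_zero] at h2
    rw [← h2]
    congr 1 with y
    rw [ENNReal.toReal_ofReal (hk0 y), smul_eq_mul, real_inner_comm]
    simp only [hk, one_mul]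
    ring
  have hsymm : ρ.map (fun y => (-1 : ℝ) • y) = ρ := by
    refine Measure.ext_of_charFun (funext fun ξ => ?_)
    rw [charFun_map_smul, neg_one_smul, charFun_neg]
    exact Complex.conj_eq_iff_im.2 (him ξ)
  have key : ∀ f : ℝ → ℝ≥0∞, Measurable f → f 0 = 0 →
      ∫⁻ y, f (y 0) ∂ν = ∫⁻ y, f (y 0) / ENNReal.ofReal (k y) ∂ρ := fun f hf hf0 => by
    rw [hρ, lintegral_withDensity_eq_lintegral_mul _ (by fun_prop) (by fun_prop)]
    refine lintegral_congr fun y => ?_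
    rw [Pi.mul_apply]
    by_cases hy : y 0 = 0
    · simp [hy, hf0]
    · have := two_sub_cos_sub_cos_sqrt_two_pos hy
      rw [ENNReal.mul_div_cancel (by simpa using this) (by simp)]
  rw [key g hg hg0, key (fun s => g (-s)) (by fun_prop) (by simpa using hg0)]
  conv_rhs => rw [← hsymm]
  rw [lintegral_map (by fun_prop) (by fun_prop)]
  simp [hk]

end IsRadialExponent

/-! ### Comparison of exponents through the tails of the Lévy measures -/

/-- Layer-cake comparison: if `ν` has heavier tails than `ν'` along `p`, then it gives larger
integrals to `min(1, (T p)²)`, up to the contribution of the set where `p` is bounded. -/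
theorem lintegral_min_le_of_tail_le {ν ν' : Measure (EuclideanSpace ℝ (Fin 2))}
    (hν' : IsLevyMeasure ν') {p : EuclideanSpace ℝ (Fin 2) → ℝ} (hp : Measurable p)
    (hp0 : ∀ y, 0 ≤ p y) (hpn : ∀ y, p y ≤ ‖y‖) {v : ℝ} (hv : 0 ≤ v)
    (htail : ∀ u, v ≤ u → ν' {y | u < p y} ≤ ν {y | u < p y}) :
    ∃ K : ℝ, 0 ≤ K ∧ ∀ T : ℝ, 0 ≤ T →
      ∫⁻ y, ENNReal.ofReal (min 1 ((T * p y) ^ 2)) ∂ν' ≤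
        ENNReal.ofReal (K * T ^ 2) + ∫⁻ y, ENNReal.ofReal (min 1 ((T * p y) ^ 2)) ∂ν := by
  set m : ℝ := (∫⁻ y, ENNReal.ofReal (min 1 (‖y‖ ^ 2)) ∂ν').toReal with hm
  refine ⟨(1 + v ^ 2) * m, by positivity, fun T hT => ?_⟩
  set S : Set (EuclideanSpace ℝ (Fin 2)) := {y | v < p y} with hS
  have hSm : MeasurableSet S := measurableSet_lt measurable_const hp
  set f : EuclideanSpace ℝ (Fin 2) → ℝ := S.indicator fun y => min 1 ((T * p y) ^ 2) with hf
  have hfm : Measurable f := Measurable.indicator (by fun_prop) hSm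
  have hf0 : ∀ y, 0 ≤ f y := indicator_nonneg fun y _ => by positivity
  have hpoint : ∀ y, ENNReal.ofReal (min 1 ((T * p y) ^ 2)) ≤
      ENNReal.ofReal ((1 + v ^ 2) * T ^ 2) * ENNReal.ofReal (min 1 (‖y‖ ^ 2))
        + ENNReal.ofReal (f y) := fun y => by
    rw [← ENNReal.ofReal_mul (by positivity), ← ENNReal.ofReal_add (by positivity) (hf0 y)]
    refine ENNReal.ofReal_le_ofReal ?_
    by_cases hy : y ∈ S
    · rw [hf, indicator_of_mem hy]
      have : 0 ≤ (1 + v ^ 2) * T ^ 2 * min 1 (‖y‖ ^ 2) := by positivity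
      linarith
    · rw [hf, indicator_of_notMem hy, add_zero]
      have h1 : p y ≤ v := not_lt.1 hy
      have h2 : p y ^ 2 ≤ v ^ 2 := pow_le_pow_left₀ (hp0 y) h1 2
      have h3 : p y ^ 2 ≤ ‖y‖ ^ 2 := pow_le_pow_left₀ (hp0 y) (hpn y) 2
      have h4 : p y ^ 2 ≤ (1 + v ^ 2) * min 1 (‖y‖ ^ 2) := by
        rcases min_cases 1 (‖y‖ ^ 2) with ⟨e, -⟩ | ⟨e, -⟩ <;> rw [e]
        · linarith
        · nlinarith [sq_nonneg v, sq_nonneg ‖y‖, mul_nonneg (sq_nonneg v) (sq_nonneg ‖y‖)]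
      refine (min_le_right _ _).trans ?_
      rw [mul_pow]
      nlinarith [mul_le_mul_of_nonneg_left h4 (sq_nonneg T)]
  have hlevel : ∀ t ∈ Ioi (0 : ℝ), ν' {y | t < f y} ≤ ν {y | t < f y} := fun t ht => by
    rw [mem_Ioi] at ht
    by_cases hcase : t < 1 ∧ 0 < T
    · have hset : {y | t < f y} = {y | max v (√t / T) < p y} := by
        ext y
        simp only [mem_ofPred_eq, max_lt_iff]
        constructor
        · intro h
          have hy : y ∈ S := by
            by_contra hy
            rw [hf, indicator_of_notMem hy] at h
            exact absurd h (not_lt.2 ht.le)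
          rw [hf, indicator_of_mem hy, lt_min_iff] at h
          refine ⟨hy, ?_⟩
          rw [div_lt_iff₀ hcase.2, mul_comm, Real.sqrt_lt' (by
            have : 0 < p y := hv.trans_lt hy
            have := hcase.2
            positivity)]
          exact h.2
        · rintro ⟨hy, h⟩
          rw [hf, indicator_of_mem (show y ∈ S from hy), lt_min_iff]
          refine ⟨hcase.1, ?_⟩
          rw [div_lt_iff₀ hcase.2, mul_comm] at h
          exact (Real.sqrt_lt' ((Real.sqrt_nonneg t).trans_lt h)).1 h
      rw [hset]
      exact htail _ (le_max_left _ _)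
    · have hset : {y | t < f y} = ∅ := by
        refine eq_empty_of_forall_notMem fun y (h : t < f y) => hcase ?_
        by_cases hy : y ∈ S
        · rw [hf, indicator_of_mem hy, lt_min_iff] at h
          refine ⟨h.1, hT.lt_of_ne fun h0 => ?_⟩
          rw [← h0] at h
          norm_num at h
          linarith
        · rw [hf, indicator_of_notMem hy] at h
          linarith
      simp [hset]
  calc ∫⁻ y, ENNReal.ofReal (min 1 ((T * p y) ^ 2)) ∂ν'
      ≤ ∫⁻ y, (ENNReal.ofReal ((1 + v ^ 2) * T ^ 2) * ENNReal.ofReal (min 1 (‖y‖ ^ 2))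
        + ENNReal.ofReal (f y)) ∂ν' := lintegral_mono hpoint
    _ = ENNReal.ofReal ((1 + v ^ 2) * m * T ^ 2) + ∫⁻ y, ENNReal.ofReal (f y) ∂ν' := by
        rw [lintegral_add_left (by fun_prop), lintegral_const_mul' _ _ (by simp),
          ← ENNReal.ofReal_toReal hν'.2.ne, ← hm, ← ENNReal.ofReal_mul (by positivity)]
        congr 2
        ring
    _ ≤ ENNReal.ofReal ((1 + v ^ 2) * m * T ^ 2) + ∫⁻ y, ENNReal.ofReal (f y) ∂ν := by
        refine add_le_add le_rfl ?_
        rw [lintegral_eq_lintegral_meas_lt ν' (ae_of_all _ hf0) hfm.aemeasurable,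
          lintegral_eq_lintegral_meas_lt ν (ae_of_all _ hf0) hfm.aemeasurable]
        exact setLIntegral_mono' measurableSet_Ioi hlevel
    _ ≤ _ := by
        gcongr with y
        exact indicator_le_self' (fun y _ => by positivity) y

/-- A comparison on complements of open balls carries over to complements of closed balls, by
continuity from below. -/
theorem measure_lt_norm_le {ν ν' : Measure (EuclideanSpace ℝ (Fin 2))} {v : ℝ}
    (h : ∀ u, v ≤ u → ν' (Metric.ball 0 u)ᶜ ≤ ν (Metric.ball 0 u)ᶜ) {u : ℝ} (hu : v ≤ u) :
    ν' {y | u < ‖y‖} ≤ ν {y | u < ‖y‖} := by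
  have hU : {y : EuclideanSpace ℝ (Fin 2) | u < ‖y‖}
      = ⋃ n : ℕ, (Metric.ball (0 : EuclideanSpace ℝ (Fin 2)) (u + 1 / (n + 1)))ᶜ := by
    ext y
    simp only [mem_ofPred_eq, mem_iUnion, mem_compl_iff, mem_ball_zero_iff, not_lt]
    constructor
    · intro hy
      obtain ⟨n, hn⟩ := exists_nat_one_div_lt (sub_pos.2 hy)
      exact ⟨n, by linarith⟩
    · rintro ⟨n, hn⟩
      have : (0 : ℝ) < 1 / (n + 1) := by positivity
      linarith
  have hmono : Monotone fun n : ℕ =>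
      (Metric.ball (0 : EuclideanSpace ℝ (Fin 2)) (u + 1 / ((n : ℝ) + 1)))ᶜ := by
    intro m n hmn
    refine compl_subset_compl.2 (Metric.ball_subset_ball ?_)
    have : (m : ℝ) ≤ n := by exact_mod_cast hmn
    gcongr
  rw [hU, hmono.measure_iUnion, hmono.measure_iUnion]
  refine iSup_mono fun n => h _ ?_
  have : (0 : ℝ) < 1 / ((n : ℝ) + 1) := by positivity
  linarith

/-- The exponent whose Lévy measure has the lighter tails is dominated near the origin, up to a
term of order `‖ξ‖²`. -/
theorem TailsDominate.exists_re_le {ν ν' : Measure (EuclideanSpace ℝ (Fin 2))}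
    {q q' : EuclideanSpace ℝ (Fin 2) → ℂ} (h : TailsDominate ν ν')
    (hq : IsRadialExponent q ν) (hq' : IsRadialExponent q' ν') :
    ∃ K : ℝ, 0 < K ∧ ∀ ξ, (q' ξ).re ≤ K * (‖ξ‖ ^ 2 + (q ξ).re) := by
  -- Only the first coordinate enters the upper bound for `q'`, so that both forms of the tail
  -- condition can be used: `|y 0| ≤ ‖y‖` for balls, symmetry of the marginal for half-planes.
  suffices H : ∃ K : ℝ, 0 ≤ K ∧ ∀ ξ, ∫⁻ y, ENNReal.ofReal (min 1 ((‖ξ‖ * y 0) ^ 2)) ∂ν' ≤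
      ENNReal.ofReal (K * ‖ξ‖ ^ 2) + 160 * ENNReal.ofReal (q ξ).re by
    obtain ⟨K, hK, h1⟩ := H
    obtain ⟨K', hK', h2⟩ := hq'.exists_re_le
    refine ⟨K' + 2 * K + 320, by positivity, fun ξ => ?_⟩
    have hr := hq.re_nonneg ξ
    have h3 : ENNReal.ofReal (q' ξ).re ≤
        ENNReal.ofReal (K' * ‖ξ‖ ^ 2 + 2 * (K * ‖ξ‖ ^ 2 + 160 * (q ξ).re)) := by
      rw [ENNReal.ofReal_add (by positivity) (by positivity), ENNReal.ofReal_mul zero_le_two,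
        ENNReal.ofReal_add (by positivity) (by positivity),
        ENNReal.ofReal_mul (p := 160) (by norm_num)]
      refine (h2 ξ).trans ?_
      simp only [ENNReal.ofReal_ofNat]
      gcongr
      exact h1 ξ
    rw [ENNReal.ofReal_le_ofReal_iff (by positivity)] at h3
    nlinarith [mul_nonneg hK' hr, mul_nonneg hK hr, sq_nonneg ‖ξ‖]
  obtain ⟨v, hv, h | h⟩ := h
  · obtain ⟨K, hK, h1⟩ := lintegral_min_le_of_tail_le hq'.levy (p := fun y => ‖y‖) (by fun_prop)
      (fun y => norm_nonneg y) (fun y => le_rfl) hv (fun u hu => measure_lt_norm_le h hu)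
    refine ⟨K, hK, fun ξ => ?_⟩
    refine le_trans (lintegral_mono fun y => ?_) ((h1 ‖ξ‖ (norm_nonneg ξ)).trans
      (add_le_add le_rfl (hq.lintegral_min_norm_le ξ)))
    refine ENNReal.ofReal_le_ofReal (min_le_min le_rfl ?_)
    rw [mul_pow, mul_pow]
    gcongr ?_ * ?_
    rw [← sq_abs]
    exact pow_le_pow_left₀ (abs_nonneg _) (PiLp.norm_apply_le y 0) 2
  · have htail : ∀ u, v ≤ u → ν' {y | u < max (y 0) 0} ≤ ν {y | u < max (y 0) 0} := by
      intro u hu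
      have : ∀ s : ℝ, u < max s 0 ↔ u < s := fun s => by
        rw [lt_max_iff]
        exact ⟨fun h => h.resolve_right (by linarith), Or.inl⟩
      simpa only [this] using h u hu
    obtain ⟨K, hK, h1⟩ := lintegral_min_le_of_tail_le hq'.levy (p := fun y => max (y 0) 0)
      (by fun_prop) (fun y => le_max_right _ _)
      (fun y => max_le ((le_abs_self _).trans (PiLp.norm_apply_le y 0)) (norm_nonneg y)) hv htail
    refine ⟨2 * K, by positivity, fun ξ => ?_⟩
    set g : ℝ → ℝ≥0∞ := fun s => ENNReal.ofReal (min 1 ((‖ξ‖ * max s 0) ^ 2)) with hg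
    have hle : ∀ y : EuclideanSpace ℝ (Fin 2), g (y 0) ≤
        ENNReal.ofReal (min 1 ((‖ξ‖ * y 0) ^ 2)) := fun y => by
      refine ENNReal.ofReal_le_ofReal (min_le_min le_rfl ?_)
      rw [mul_pow, mul_pow]
      gcongr ?_ * ?_
      rcases max_cases (y 0) 0 with ⟨e, -⟩ | ⟨e, -⟩ <;> rw [e]
      nlinarith [sq_nonneg (y 0)]
    calc ∫⁻ y, ENNReal.ofReal (min 1 ((‖ξ‖ * y 0) ^ 2)) ∂ν'
        ≤ ∫⁻ y, (g (y 0) + g (-y 0)) ∂ν' := by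
          refine lintegral_mono fun y => ?_
          rcases le_total 0 (y 0) with h0 | h0
          · refine le_trans (le_of_eq ?_) le_self_add
            simp only [hg, max_eq_left h0]
          · refine le_trans (le_of_eq ?_) le_add_self
            simp only [hg, max_eq_left (neg_nonneg.2 h0), mul_neg, neg_sq]
      _ = 2 * ∫⁻ y, g (y 0) ∂ν' := by
          rw [lintegral_add_left (by fun_prop),
            hq'.lintegral_coord_neg (by fun_prop) (by simp [hg]), two_mul]
      _ ≤ 2 * (ENNReal.ofReal (K * ‖ξ‖ ^ 2) + 80 * ENNReal.ofReal (q ξ).re) := by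
          gcongr
          refine (h1 ‖ξ‖ (norm_nonneg ξ)).trans (add_le_add le_rfl ?_)
          exact (lintegral_mono hle).trans (hq.lintegral_min_coord_le 0 ξ)
      _ = _ := by
          rw [mul_add, ← mul_assoc, mul_assoc 2 K, ENNReal.ofReal_mul zero_le_two]
          norm_num

/-! ### The Chung–Fuchs criterion -/

theorem integral_charFun_eq_integral_charFun (μ σ : Measure (EuclideanSpace ℝ (Fin 2)))
    [IsFiniteMeasure μ] [IsFiniteMeasure σ] :
    ∫ y, charFun σ y ∂μ = ∫ ξ, charFun μ ξ ∂σ := by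
  simp only [charFun_apply]
  rw [integral_integral_swap]
  · simp only [real_inner_comm]
  · refine Integrable.of_bound (C := 1) ?_ (ae_of_all _ fun y => by
      rw [Function.uncurry, Complex.norm_exp_ofReal_mul_I])
    apply Measurable.aestronglyMeasurable
    fun_prop

theorem integrable_exp_neg_mul_norm_sq {s : ℝ} (hs : 0 < s) :
    Integrable fun ξ : EuclideanSpace ℝ (Fin 2) => Real.exp (-s * ‖ξ‖ ^ 2) := by
  have h := (GaussianFourier.integrable_cexp_neg_mul_sq_norm_add (b := (s : ℂ)) (by simpa using hs)
    0 (0 : EuclideanSpace ℝ (Fin 2))).re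
  refine h.congr (ae_of_all _ fun ξ => ?_)
  simp only [zero_mul, add_zero, RCLike.re_to_complex]
  rw [← Complex.exp_ofReal_re]
  push_cast
  rfl

/-- Parseval's identity for a Gaussian and a finite measure with real characteristic
function. -/
theorem integral_exp_mul_charFun {μ : Measure (EuclideanSpace ℝ (Fin 2))} [IsFiniteMeasure μ]
    {φ : EuclideanSpace ℝ (Fin 2) → ℝ} (hφ : ∀ ξ, charFun μ ξ = (φ ξ : ℂ)) {s : ℝ} (hs : 0 < s) :
    ∫ ξ, Real.exp (-s * ‖ξ‖ ^ 2) * φ ξ = ∫ y, Real.pi / s * Real.exp (-‖y‖ ^ 2 / (4 * s)) ∂μ := by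
  set σ : Measure (EuclideanSpace ℝ (Fin 2)) :=
    volume.withDensity fun ξ => ENNReal.ofReal (Real.exp (-s * ‖ξ‖ ^ 2)) with hσ
  have hfin : IsFiniteMeasure σ := isFiniteMeasure_withDensity
    ((hasFiniteIntegral_iff_ofReal (ae_of_all _ fun ξ => (Real.exp_pos _).le)).1
      (integrable_exp_neg_mul_norm_sq hs).2).ne
  have h1 : ∀ y, charFun σ y = ((Real.pi / s * Real.exp (-‖y‖ ^ 2 / (4 * s)) : ℝ) : ℂ) := fun y => by
    rw [charFun_apply, hσ, integral_withDensity_eq_integral_toReal_smul (by fun_prop) (by simp)]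
    have h := GaussianFourier.integral_cexp_neg_mul_sq_norm_add (b := (s : ℂ)) (by simpa using hs)
      Complex.I y
    rw [finrank_euclideanSpace_fin] at h
    push_cast
    rw [Complex.I_sq] at h
    norm_num at h
    rw [← h]
    congr 1 with ξ
    rw [ENNReal.toReal_ofReal (Real.exp_pos _).le, Complex.exp_add, real_inner_comm,
      Complex.real_smul]
    push_cast
    rw [mul_comm Complex.I, neg_mul]
  have h2 := integral_charFun_eq_integral_charFun μ σ
  simp only [h1, hφ] at h2
  rw [integral_complex_ofReal, integral_complex_ofReal, Complex.ofReal_inj] at h2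
  rw [h2, hσ, integral_withDensity_eq_integral_toReal_smul (by fun_prop) (by simp)]
  congr 1 with ξ
  rw [ENNReal.toReal_ofReal (Real.exp_pos _).le, smul_eq_mul]

/-- A ball carries at least a multiple of the integral of a nonnegative characteristic function
near the origin. -/
theorem lintegral_charFun_le_measure_ball {μ : Measure (EuclideanSpace ℝ (Fin 2))}
    [IsFiniteMeasure μ] {φ : EuclideanSpace ℝ (Fin 2) → ℝ} (hφ : ∀ ξ, charFun μ ξ = (φ ξ : ℂ))
    (hφm : Measurable φ) (hφ0 : ∀ ξ, 0 ≤ φ ξ) :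
    ∫⁻ ξ in Metric.ball (0 : EuclideanSpace ℝ (Fin 2)) 1, ENNReal.ofReal (φ ξ) ≤
      ENNReal.ofReal (16 * Real.pi) * μ (Metric.ball 0 2) := by
  have hint : ∀ s : ℝ, 0 < s → Integrable fun ξ => Real.exp (-s * ‖ξ‖ ^ 2) * φ ξ := fun s hs => by
    refine (integrable_exp_neg_mul_norm_sq hs).mul_bdd (c := μ.real univ)
      hφm.aestronglyMeasurable (ae_of_all _ fun ξ => ?_)
    rw [← Complex.norm_real, ← hφ]
    exact norm_charFun_le ξ
  have hintμ : ∀ s : ℝ, 0 < s → Integrable (fun y : EuclideanSpace ℝ (Fin 2) =>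
      Real.pi / s * Real.exp (-‖y‖ ^ 2 / (4 * s))) μ := fun s hs => by
    refine Integrable.of_bound (C := Real.pi / s) (by fun_prop) (ae_of_all _ fun y => ?_)
    rw [Real.norm_of_nonneg (by positivity)]
    refine mul_le_of_le_one_right (by positivity) (Real.exp_le_one_iff.2 ?_)
    rw [neg_div]
    exact neg_nonpos.2 (by positivity)
  -- The test function `8π exp(-|y|²) - 2π exp(-|y|²/2)` is nonpositive for `|y| ≥ 2`, and it is
  -- the Fourier transform of `2 exp(-|ξ|²/4) - exp(-|ξ|²/2) ≥ exp(-|ξ|²/4)`.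
  have hlow : ∫ ξ, Real.exp (-(1 / 4) * ‖ξ‖ ^ 2) * φ ξ ≤
      ∫ ξ, (2 * (Real.exp (-(1 / 4) * ‖ξ‖ ^ 2) * φ ξ) - Real.exp (-(1 / 2) * ‖ξ‖ ^ 2) * φ ξ) := by
    refine integral_mono (hint _ (by norm_num)) (((hint _ (by norm_num)).const_mul 2).sub
      (hint _ (by norm_num))) fun ξ => ?_
    have : Real.exp (-(1 / 2) * ‖ξ‖ ^ 2) ≤ Real.exp (-(1 / 4) * ‖ξ‖ ^ 2) :=
      Real.exp_le_exp.2 (by nlinarith [sq_nonneg ‖ξ‖])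
    have := mul_le_mul_of_nonneg_right this (hφ0 ξ)
    simp only
    linarith
  have hup : ∫ y, (2 * (Real.pi / (1 / 4) * Real.exp (-‖y‖ ^ 2 / (4 * (1 / 4)))) -
      Real.pi / (1 / 2) * Real.exp (-‖y‖ ^ 2 / (4 * (1 / 2)))) ∂μ ≤
      8 * Real.pi * μ.real (Metric.ball 0 2) := by
    have h1 : 8 * Real.pi * μ.real (Metric.ball 0 2) = ∫ y, (Metric.ball
        (0 : EuclideanSpace ℝ (Fin 2)) 2).indicator (fun _ => 8 * Real.pi) y ∂μ := by
      rw [integral_indicator_const _ measurableSet_ball, smul_eq_mul, mul_comm]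
    rw [h1]
    refine integral_mono (((hintμ _ (by norm_num)).const_mul 2).sub (hintμ _ (by norm_num)))
      ((integrable_const _).indicator measurableSet_ball) fun y => ?_
    have hpi := Real.pi_pos
    have e : Real.exp (-‖y‖ ^ 2 / (4 * (1 / 4))) = Real.exp (-‖y‖ ^ 2 / 2) ^ 2 := by
      rw [← Real.exp_nat_mul]
      congr 1
      push_cast
      ring
    have e' : -‖y‖ ^ 2 / (4 * (1 / 2)) = -‖y‖ ^ 2 / 2 := by ring
    simp only [e, e']
    set x := Real.exp (-‖y‖ ^ 2 / 2) with hx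
    have hx0 : 0 < x := Real.exp_pos _
    have hx1 : x ≤ 1 := Real.exp_le_one_iff.2 (by
      rw [neg_div]
      exact neg_nonpos.2 (by positivity))
    by_cases hy : y ∈ Metric.ball (0 : EuclideanSpace ℝ (Fin 2)) 2
    · rw [indicator_of_mem hy]
      have : 8 * Real.pi * x ^ 2 ≤ 8 * Real.pi * 1 :=
        mul_le_mul_of_nonneg_left (pow_le_one₀ hx0.le hx1) (by positivity)
      nlinarith [mul_pos hpi hx0]
    · rw [indicator_of_notMem hy]
      have hy2 : 2 ≤ ‖y‖ := by simpa using hy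
      have hx4 : x ≤ 1 / 4 := by
        have h2 : x ≤ Real.exp (-2) := Real.exp_le_exp.2 (by nlinarith)
        have h3 : (4 : ℝ) ≤ Real.exp 2 := by
          have := Real.exp_one_gt_d9
          rw [show (2 : ℝ) = 1 + 1 by norm_num, Real.exp_add]
          nlinarith
        rw [Real.exp_neg] at h2
        refine h2.trans ?_
        rw [one_div]
        exact inv_anti₀ (by norm_num) h3
      have : Real.pi * x * x ≤ Real.pi * x * (1 / 4) :=
        mul_le_mul_of_nonneg_left hx4 (by positivity)
      nlinarith
  have hmid : ∫ ξ, (2 * (Real.exp (-(1 / 4) * ‖ξ‖ ^ 2) * φ ξ) -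
      Real.exp (-(1 / 2) * ‖ξ‖ ^ 2) * φ ξ) =
      ∫ y, (2 * (Real.pi / (1 / 4) * Real.exp (-‖y‖ ^ 2 / (4 * (1 / 4)))) -
      Real.pi / (1 / 2) * Real.exp (-‖y‖ ^ 2 / (4 * (1 / 2)))) ∂μ := by
    rw [integral_sub ((hint _ (by norm_num)).const_mul 2) (hint _ (by norm_num)),
      integral_const_mul, integral_exp_mul_charFun hφ (by norm_num),
      integral_exp_mul_charFun hφ (by norm_num), ← integral_const_mul, ← integral_sub
      ((hintμ _ (by norm_num)).const_mul 2) (hintμ _ (by norm_num))]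
  calc ∫⁻ ξ in Metric.ball (0 : EuclideanSpace ℝ (Fin 2)) 1, ENNReal.ofReal (φ ξ)
      ≤ ∫⁻ ξ in Metric.ball (0 : EuclideanSpace ℝ (Fin 2)) 1,
          2 * ENNReal.ofReal (Real.exp (-(1 / 4) * ‖ξ‖ ^ 2) * φ ξ) := by
        refine setLIntegral_mono (by fun_prop) fun ξ hξ => ?_
        rw [show (2 : ℝ≥0∞) * ENNReal.ofReal (Real.exp (-(1 / 4) * ‖ξ‖ ^ 2) * φ ξ) =
          ENNReal.ofReal (2 * (Real.exp (-(1 / 4) * ‖ξ‖ ^ 2) * φ ξ)) by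
            rw [ENNReal.ofReal_mul zero_le_two, ENNReal.ofReal_ofNat]]
        refine ENNReal.ofReal_le_ofReal ?_
        have h1 : ‖ξ‖ < 1 := by simpa using hξ
        have h2 := Real.add_one_le_exp (-(1 / 4) * ‖ξ‖ ^ 2)
        have h3 : 1 ≤ 2 * Real.exp (-(1 / 4) * ‖ξ‖ ^ 2) := by
          nlinarith [norm_nonneg ξ]
        nlinarith [hφ0 ξ]
    _ ≤ ∫⁻ ξ, 2 * ENNReal.ofReal (Real.exp (-(1 / 4) * ‖ξ‖ ^ 2) * φ ξ) :=
        setLIntegral_le_lintegral _ _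
    _ = ENNReal.ofReal (2 * ∫ ξ, Real.exp (-(1 / 4) * ‖ξ‖ ^ 2) * φ ξ) := by
        rw [lintegral_const_mul' _ _ (by simp), ENNReal.ofReal_mul zero_le_two,
          ofReal_integral_eq_lintegral_ofReal (hint _ (by norm_num))
          (ae_of_all _ fun ξ => mul_nonneg (Real.exp_pos _).le (hφ0 ξ)), ENNReal.ofReal_ofNat]
    _ ≤ ENNReal.ofReal (16 * Real.pi * μ.real (Metric.ball 0 2)) :=
        ENNReal.ofReal_le_ofReal (by linarith [hmid ▸ hlow])
    _ = _ := by
        rw [ENNReal.ofReal_mul (by positivity), ofReal_measureReal]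

/-- A ball carries at most a multiple of the integral of a nonnegative characteristic function
against the autocorrelation of a ball: test with the squared modulus of the Fourier transform of
the indicator of a ball. -/
theorem measure_ball_le_lintegral_charFun {μ : Measure (EuclideanSpace ℝ (Fin 2))}
    [IsFiniteMeasure μ] {φ : EuclideanSpace ℝ (Fin 2) → ℝ} (hφ : ∀ ξ, charFun μ ξ = (φ ξ : ℂ))
    (hφm : Measurable φ) (hφ0 : ∀ ξ, 0 ≤ φ ξ)
    {ρ : Measure (EuclideanSpace ℝ (Fin 2))} [IsFiniteMeasure ρ] {r c : ℝ} (hc : 0 ≤ c)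
    (hρ : ∀ y ∈ Metric.ball (0 : EuclideanSpace ℝ (Fin 2)) r, c ≤ ‖charFun ρ y‖) :
    ENNReal.ofReal (c ^ 2) * μ (Metric.ball 0 r) ≤
      ∫⁻ ξ, ∫⁻ η, ENNReal.ofReal (φ (ξ - η)) ∂ρ ∂ρ := by
  set σ := ρ ∗ ρ.map (fun y => (-1 : ℝ) • y) with hσ
  have h1 : ∀ y, charFun σ y = ((‖charFun ρ y‖ ^ 2 : ℝ) : ℂ) := fun y => by
    rw [hσ, charFun_conv, charFun_map_smul, neg_one_smul, charFun_neg, Complex.mul_conj,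
      Complex.normSq_eq_norm_sq]
  have h2 := integral_charFun_eq_integral_charFun μ σ
  simp only [h1, hφ] at h2
  rw [integral_complex_ofReal, integral_complex_ofReal, Complex.ofReal_inj] at h2
  have hρm : Measurable (charFun ρ) := measurable_charFun
  have hiμ : Integrable (fun y => ‖charFun ρ y‖ ^ 2) μ := by
    refine Integrable.of_bound (C := ρ.real univ ^ 2) (by fun_prop) (ae_of_all _ fun y => ?_)
    rw [Real.norm_of_nonneg (by positivity)]
    exact pow_le_pow_left₀ (norm_nonneg _) (norm_charFun_le y) 2
  have hiσ : Integrable φ σ := by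
    refine Integrable.of_bound (C := μ.real univ) hφm.aestronglyMeasurable
      (ae_of_all _ fun ξ => ?_)
    rw [← Complex.norm_real, ← hφ]
    exact norm_charFun_le ξ
  calc ENNReal.ofReal (c ^ 2) * μ (Metric.ball 0 r)
      = ∫⁻ y in Metric.ball 0 r, ENNReal.ofReal (c ^ 2) ∂μ := by simp
    _ ≤ ∫⁻ y in Metric.ball 0 r, ENNReal.ofReal (‖charFun ρ y‖ ^ 2) ∂μ :=
        setLIntegral_mono (by fun_prop) fun y hy =>
          ENNReal.ofReal_le_ofReal (pow_le_pow_left₀ hc (hρ y hy) 2)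
    _ ≤ ∫⁻ y, ENNReal.ofReal (‖charFun ρ y‖ ^ 2) ∂μ := setLIntegral_le_lintegral _ _
    _ = ∫⁻ ξ, ENNReal.ofReal (φ ξ) ∂σ := by
        rw [← ofReal_integral_eq_lintegral_ofReal hiμ (ae_of_all _ fun y => by positivity), h2,
          ofReal_integral_eq_lintegral_ofReal hiσ (ae_of_all _ hφ0)]
    _ = _ := by
        rw [hσ, Measure.lintegral_conv (by fun_prop)]
        refine lintegral_congr fun ξ => ?_
        rw [lintegral_map (by fun_prop) (by fun_prop)]
        simp [sub_eq_add_neg]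

theorem half_volume_le_norm_charFun {r : ℝ} (hr : 0 < r) {y : EuclideanSpace ℝ (Fin 2)}
    (hy : y ∈ Metric.ball (0 : EuclideanSpace ℝ (Fin 2)) r⁻¹) :
    volume.real (Metric.ball (0 : EuclideanSpace ℝ (Fin 2)) r) / 2 ≤
      ‖charFun (volume.restrict (Metric.ball (0 : EuclideanSpace ℝ (Fin 2)) r)) y‖ := by
  have : IsFiniteMeasure (volume.restrict (Metric.ball (0 : EuclideanSpace ℝ (Fin 2)) r)) :=
    ⟨by rw [Measure.restrict_apply_univ]; exact measure_ball_lt_top⟩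
  set ρ := volume.restrict (Metric.ball (0 : EuclideanSpace ℝ (Fin 2)) r)
  have hint : Integrable (fun x => Complex.exp ((inner ℝ x y : ℝ) * Complex.I)) ρ :=
    Integrable.of_bound (C := 1) (by fun_prop) (ae_of_all _ fun y => by
      rw [Complex.norm_exp_ofReal_mul_I])
  refine le_trans ?_ (Complex.re_le_norm _)
  have h1 := integral_re hint
  simp only [RCLike.re_to_complex, Complex.exp_ofReal_mul_I_re] at h1
  rw [charFun_apply, ← h1]
  have h2 : volume.real (Metric.ball (0 : EuclideanSpace ℝ (Fin 2)) r) / 2 = ∫ x, 1 / 2 ∂ρ := by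
    simp [ρ, div_eq_mul_inv]
  rw [h2]
  refine integral_mono_ae (integrable_const _) (Integrable.of_bound (C := 1) (by fun_prop)
    (ae_of_all _ fun y => Real.abs_cos_le_one _)) ?_
  filter_upwards [ae_restrict_mem measurableSet_ball] with x hx
  have hx1 : ‖x‖ < r := by simpa using hx
  have hy1 : ‖y‖ < r⁻¹ := by simpa using hy
  have h3 : |inner ℝ x y| ≤ 1 := (abs_real_inner_le_norm x y).trans (by
    calc ‖x‖ * ‖y‖ ≤ r * r⁻¹ := mul_le_mul hx1.le hy1.le (norm_nonneg _) hr.le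
      _ = 1 := mul_inv_cancel₀ hr.ne')
  have h4 : (inner ℝ x y : ℝ) ^ 2 ≤ 1 := (sq_le_one_iff_abs_le_one _).2 h3
  linarith [Real.one_sub_sq_div_two_le_cos (x := inner ℝ x y)]

theorem lintegral_exp_neg_mul {a : ℝ} (ha : 0 ≤ a) :
    ∫⁻ t in Ioi (0 : ℝ), ENNReal.ofReal (Real.exp (-t * a)) = (ENNReal.ofReal a)⁻¹ := by
  rcases ha.eq_or_lt with rfl | ha
  · simp
  · have hi : IntegrableOn (fun t => Real.exp (-t * a)) (Ioi 0) := by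
      simpa [mul_comm] using integrableOn_exp_mul_Ioi (neg_lt_zero.2 ha) 0
    have hv : ∫ t in Ioi (0 : ℝ), Real.exp (-t * a) = a⁻¹ := by
      simpa [mul_comm, neg_div] using integral_exp_mul_Ioi (neg_lt_zero.2 ha) 0
    rw [← ofReal_integral_eq_lintegral_ofReal hi (ae_of_all _ fun t => (Real.exp_pos _).le), hv,
      ENNReal.ofReal_inv_of_pos ha]

section ChungFuchs

variable {Ω : Type*} [MeasurableSpace Ω] {P : EuclideanSpace ℝ (Fin 2) → Measure Ω}
  {L : ℝ≥0 → Ω → EuclideanSpace ℝ (Fin 2)} {q : EuclideanSpace ℝ (Fin 2) → ℂ}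
  {ν : Measure (EuclideanSpace ℝ (Fin 2))}

theorem charFun_map_levy (hL : IsLevyProcess P L) (hq : HasLevySymbol P L q ν)
    (hr : IsRadialExponent q ν) (t : ℝ≥0) (ξ : EuclideanSpace ℝ (Fin 2)) :
    charFun ((P 0).map (L t)) ξ = ((Real.exp (-t * (q ξ).re) : ℝ) : ℂ) := by
  rw [charFun_apply, integral_map (hL.measurable t).aemeasurable (by fun_prop)]
  have h := hq.charFun_eq 0 t ξ
  simp only [sub_zero] at h
  push_cast
  rw [hr.coe_re, ← h]
  congr 1 with ω
  rw [mul_comm, real_inner_comm]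

theorem measurable_re_exponent (hL : IsLevyProcess P L) (hq : HasLevySymbol P L q ν)
    (hr : IsRadialExponent q ν) : Measurable fun ξ => (q ξ).re := by
  have := hL.isProbabilityMeasure 0
  have hm : Measurable (charFun ((P 0).map (L 1))) := measurable_charFun
  have h : ∀ ξ, (q ξ).re = -Real.log (charFun ((P 0).map (L 1)) ξ).re := fun ξ => by
    rw [charFun_map_levy hL hq hr, Complex.ofReal_re, Real.log_exp]
    simp
  simp only [h]
  fun_prop

/-- Half of the Chung–Fuchs criterion: for a transient process `1/q` is integrable near `0`. -/
theorem IsTransientLevy.lintegral_inv_lt_top (ht : IsTransientLevy P L) (hL : IsLevyProcess P L)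
    (hq : HasLevySymbol P L q ν) (hr : IsRadialExponent q ν) :
    ∫⁻ ξ in Metric.ball (0 : EuclideanSpace ℝ (Fin 2)) 1, (ENNReal.ofReal (q ξ).re)⁻¹ < ∞ := by
  have := hL.isProbabilityMeasure 0
  have hm := measurable_re_exponent hL hq hr
  calc ∫⁻ ξ in Metric.ball (0 : EuclideanSpace ℝ (Fin 2)) 1, (ENNReal.ofReal (q ξ).re)⁻¹
      = ∫⁻ ξ in Metric.ball (0 : EuclideanSpace ℝ (Fin 2)) 1, ∫⁻ t in Ioi (0 : ℝ),
          ENNReal.ofReal (Real.exp (-t * (q ξ).re)) :=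
        lintegral_congr fun ξ => (lintegral_exp_neg_mul (hr.re_nonneg ξ)).symm
    _ = ∫⁻ t in Ioi (0 : ℝ), ∫⁻ ξ in Metric.ball (0 : EuclideanSpace ℝ (Fin 2)) 1,
          ENNReal.ofReal (Real.exp (-t * (q ξ).re)) := by
        rw [lintegral_lintegral_swap]
        exact (measurable_snd.neg.mul
          (hm.comp measurable_fst)).exp.ennreal_ofReal.aemeasurable
    _ ≤ ∫⁻ t in Ioi (0 : ℝ), ENNReal.ofReal (16 * Real.pi) *
          P 0 {ω | L t.toNNReal ω ∈ Metric.ball 0 2} := by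
        refine setLIntegral_mono' measurableSet_Ioi fun t ht => ?_
        have h := lintegral_charFun_le_measure_ball (charFun_map_levy hL hq hr t.toNNReal)
          (by fun_prop) fun ξ => (Real.exp_pos _).le
        rw [Measure.map_apply (hL.measurable _) measurableSet_ball,
          Real.coe_toNNReal t (le_of_lt ht)] at h
        exact h
    _ = ENNReal.ofReal (16 * Real.pi) * ∫⁻ t in Ioi (0 : ℝ),
          P 0 {ω | L t.toNNReal ω ∈ Metric.ball 0 2} := lintegral_const_mul' _ _ ENNReal.ofReal_ne_top
    _ < ∞ := ENNReal.mul_lt_top ENNReal.ofReal_lt_top (ht 0 2 two_pos)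

/-- Half of the Chung–Fuchs criterion: for a recurrent process `1/q` is not integrable near `0`. -/
theorem IsRecurrentLevy.lintegral_inv_eq_top (ht : IsRecurrentLevy P L) (hL : IsLevyProcess P L)
    (hq : HasLevySymbol P L q ν) (hr : IsRadialExponent q ν) {r : ℝ} (hr0 : 0 < r) :
    ∫⁻ ξ in Metric.ball (0 : EuclideanSpace ℝ (Fin 2)) r, (ENNReal.ofReal (q ξ).re)⁻¹ = ∞ := by
  have := hL.isProbabilityMeasure 0
  have hm := measurable_re_exponent hL hq hr
  set B := Metric.ball (0 : EuclideanSpace ℝ (Fin 2)) (r / 2) with hB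
  have hBfin : volume B ≠ ∞ := measure_ball_lt_top.ne
  have hfin : IsFiniteMeasure (volume.restrict B) := ⟨by simpa using hBfin.lt_top⟩
  set c : ℝ := volume.real B / 2 with hc
  have hc0 : 0 < c := half_pos (ENNReal.toReal_pos
    (Metric.measure_ball_pos _ _ (by positivity)).ne' hBfin)
  by_contra hne
  have hle : ∫⁻ t in Ioi (0 : ℝ), ENNReal.ofReal (c ^ 2) *
      P 0 {ω | L t.toNNReal ω ∈ Metric.ball 0 (r / 2)⁻¹} ≤
      volume B * ∫⁻ ξ in Metric.ball (0 : EuclideanSpace ℝ (Fin 2)) r,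
        (ENNReal.ofReal (q ξ).re)⁻¹ := by
    calc ∫⁻ t in Ioi (0 : ℝ), ENNReal.ofReal (c ^ 2) *
          P 0 {ω | L t.toNNReal ω ∈ Metric.ball 0 (r / 2)⁻¹}
        ≤ ∫⁻ t in Ioi (0 : ℝ), ∫⁻ ξ in B, ∫⁻ η in B,
            ENNReal.ofReal (Real.exp (-t * (q (ξ - η)).re)) := by
          refine setLIntegral_mono' measurableSet_Ioi fun t ht => ?_
          have h := measure_ball_le_lintegral_charFun (charFun_map_levy hL hq hr t.toNNReal)
            (by fun_prop) (fun ξ => (Real.exp_pos _).le) hc0.le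
            fun y hy => half_volume_le_norm_charFun (half_pos hr0) hy
          rw [Measure.map_apply (hL.measurable _) measurableSet_ball,
            Real.coe_toNNReal t (le_of_lt ht)] at h
          exact h
      _ = ∫⁻ ξ in B, ∫⁻ η in B, ∫⁻ t in Ioi (0 : ℝ),
            ENNReal.ofReal (Real.exp (-t * (q (ξ - η)).re)) := by
          rw [lintegral_lintegral_swap]
          · refine lintegral_congr fun ξ => ?_
            rw [lintegral_lintegral_swap]
            exact (measurable_fst.neg.mul
              (hm.comp (measurable_const.sub measurable_snd))).exp.ennreal_ofReal.aemeasurable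
          · apply Measurable.aemeasurable
            apply Measurable.lintegral_prod_right'
              (f := fun p : (ℝ × EuclideanSpace ℝ (Fin 2)) × EuclideanSpace ℝ (Fin 2) =>
                ENNReal.ofReal (Real.exp (-p.1.1 * (q (p.1.2 - p.2)).re)))
            exact ((measurable_fst.comp measurable_fst).neg.mul (hm.comp
              ((measurable_snd.comp measurable_fst).sub measurable_snd))).exp.ennreal_ofReal
      _ = ∫⁻ ξ in B, ∫⁻ η in B, (ENNReal.ofReal (q (ξ - η)).re)⁻¹ :=
          lintegral_congr fun ξ => lintegral_congr fun η =>
            lintegral_exp_neg_mul (hr.re_nonneg _)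
      _ ≤ ∫⁻ ξ in B, ∫⁻ ζ in Metric.ball (0 : EuclideanSpace ℝ (Fin 2)) r,
            (ENNReal.ofReal (q ζ).re)⁻¹ := by
          refine setLIntegral_mono' measurableSet_ball fun ξ hξ => ?_
          rw [← lintegral_indicator measurableSet_ball, ← lintegral_indicator measurableSet_ball]
          refine le_of_le_of_eq (lintegral_mono fun η => ?_) (lintegral_sub_left_eq_self _ ξ)
          by_cases hη : η ∈ B
          · have h2 : ξ - η ∈ Metric.ball (0 : EuclideanSpace ℝ (Fin 2)) r := by
              simp only [hB, mem_ball_zero_iff] at hξ hη ⊢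
              linarith [norm_sub_le ξ η]
            rw [indicator_of_mem hη, indicator_of_mem h2]
          · rw [indicator_of_notMem hη]
            exact zero_le
      _ = _ := by simp [mul_comm]
  rw [lintegral_const_mul' _ _ (by simp), ht 0 _ (by positivity), ENNReal.mul_top
    (by simpa using hc0.ne'), top_le_iff] at hle
  exact ENNReal.mul_ne_top hBfin hne hle

end ChungFuchs

/-! ### Comparison of symbols -/

theorem lintegral_inv_norm_sq_eq_top {r : ℝ} (hr : 0 < r) :
    ∫⁻ ξ in Metric.ball (0 : EuclideanSpace ℝ (Fin 2)) r, (ENNReal.ofReal (‖ξ‖ ^ 2))⁻¹ = ∞ := by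
  by_contra hne
  have hmeas : Measurable fun ξ : EuclideanSpace ℝ (Fin 2) => ‖ξ‖ ^ (-2 : ℝ) := by fun_prop
  have h1 : IntegrableOn (fun ξ : EuclideanSpace ℝ (Fin 2) => ‖ξ‖ ^ (-2 : ℝ))
      (Metric.ball 0 r) := by
    refine ⟨hmeas.aestronglyMeasurable, (hasFiniteIntegral_iff_ofReal (ae_of_all _ fun ξ =>
      Real.rpow_nonneg (norm_nonneg _) _)).2 (lt_of_le_of_lt ?_ (lt_top_iff_ne_top.2 hne))⟩
    refine lintegral_mono fun ξ => ?_
    rcases (norm_nonneg ξ).eq_or_lt with h0 | h0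
    · simp [← h0]
    · rw [← ENNReal.ofReal_inv_of_pos (by positivity), Real.rpow_neg (norm_nonneg _)]
      simp
  rw [integrableOn_fun_norm_addHaar volume (f := fun s : ℝ => s ^ (-2 : ℝ))] at h1
  have h2 : IntegrableOn (fun s : ℝ => s ^ (-1 : ℝ)) (Ioo 0 r) := by
    refine h1.congr_fun (fun s hs => ?_) measurableSet_Ioo
    simp only [finrank_euclideanSpace_fin, smul_eq_mul]
    rw [← Real.rpow_natCast, ← Real.rpow_add hs.1]
    norm_num
  rw [intervalIntegral.integrableOn_Ioo_rpow_iff hr] at h2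
  exact lt_irrefl _ h2

theorem lintegral_inv_const_mul_eq_top {B : Set (EuclideanSpace ℝ (Fin 2))}
    (hB : MeasurableSet B) {f g : EuclideanSpace ℝ (Fin 2) → ℝ} {K : ℝ} (hK : 0 < K)
    (hle : ∀ ξ ∈ B, f ξ ≤ K * g ξ) (h : ∫⁻ ξ in B, (ENNReal.ofReal (g ξ))⁻¹ = ∞) :
    ∫⁻ ξ in B, (ENNReal.ofReal (f ξ))⁻¹ = ∞ := by
  have hK0 : ENNReal.ofReal K ≠ 0 := by simpa using hK
  have h1 : ∫⁻ ξ in B, (ENNReal.ofReal K)⁻¹ * (ENNReal.ofReal (g ξ))⁻¹ ≤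
      ∫⁻ ξ in B, (ENNReal.ofReal (f ξ))⁻¹ := by
    refine setLIntegral_mono' hB fun ξ hξ => ?_
    rw [← ENNReal.mul_inv (Or.inl hK0) (Or.inl (by simp)), ← ENNReal.ofReal_mul hK.le]
    exact ENNReal.inv_le_inv.2 (ENNReal.ofReal_le_ofReal (hle ξ hξ))
  rw [lintegral_const_mul' _ _ (by simpa using hK), h, ENNReal.mul_top (by simp)] at h1
  exact top_le_iff.1 h1

theorem IsLevyTypeProcess.isRadialExponent {Ω : Type*} {mΩ : MeasurableSpace Ω}
    {ℱ : Filtration ℝ≥0 mΩ} {P : EuclideanSpace ℝ (Fin 2) → Measure Ω}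
    {F : ℝ≥0 → Ω → EuclideanSpace ℝ (Fin 2)}
    {q : EuclideanSpace ℝ (Fin 2) → EuclideanSpace ℝ (Fin 2) → ℂ}
    {ν : Kernel (EuclideanSpace ℝ (Fin 2)) (EuclideanSpace ℝ (Fin 2))}
    (hF : IsLevyTypeProcess ℱ P F q ν) (hq : ∀ x, IsRadial (q x))
    (x : EuclideanSpace ℝ (Fin 2)) : IsRadialExponent (q x) (ν x) := by
  obtain ⟨a, b, C, -, -, -, -, hC, hrep⟩ := hF.exists_representation
  have ha : a x = 0 := by
    have h := hF.symbol_zero x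
    rw [hrep] at h
    simpa [levyKhintchine] using h
  exact ⟨hq x, hF.isLevyMeasure x, b x, C x, hC x, fun ξ => by rw [hrep, ha]⟩

theorem corollary5p2
    {Ω : Type*} {mΩ : MeasurableSpace Ω} (ℱ : Filtration ℝ≥0 mΩ)
    (P : EuclideanSpace ℝ (Fin 2) → Measure Ω)
    (F : ℝ≥0 → Ω → EuclideanSpace ℝ (Fin 2))
    (q : EuclideanSpace ℝ (Fin 2) → EuclideanSpace ℝ (Fin 2) → ℂ)
    (ν : Kernel (EuclideanSpace ℝ (Fin 2)) (EuclideanSpace ℝ (Fin 2)))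
    (hF : IsLevyTypeProcess ℱ P F q ν)
    (hq : ∀ x, IsRadial (q x))
    {Ω' : Type*} [MeasurableSpace Ω']
    (P' : EuclideanSpace ℝ (Fin 2) → Measure Ω')
    (L : ℝ≥0 → Ω' → EuclideanSpace ℝ (Fin 2))
    (qL : EuclideanSpace ℝ (Fin 2) → ℂ)
    (νL : Measure (EuclideanSpace ℝ (Fin 2)))
    (hL : IsLevyProcess P' L) (hqL : HasLevySymbol P' L qL νL) (hqLrad : IsRadial qL)
    (x₀ : EuclideanSpace ℝ (Fin 2)) :
    ((∀ᶠ ξ in 𝓝 (0 : EuclideanSpace ℝ (Fin 2)),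
        IsLUB (range fun x => (q x ξ).re) (q x₀ ξ).re) →
      IsQuasiUnimodal (firstMarginal νL) →
      TailsDominate νL (ν x₀) →
      IsRecurrentLevy P' L → ChungFuchsRecurrence q) ∧
    ((∀ᶠ ξ in 𝓝 (0 : EuclideanSpace ℝ (Fin 2)),
        IsGLB (range fun x => (q x ξ).re) (q x₀ ξ).re) →
      IsQuasiUnimodal (firstMarginal (ν x₀)) →
      ∫⁻ y, ENNReal.ofReal (‖y‖ ^ 2) ∂(ν x₀) = ∞ →
      TailsDominate (ν x₀) νL →
      IsTransientLevy P' L → ChungFuchsTransience q) := by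
  have hrad := hF.isRadialExponent hq
  have hLrad : IsRadialExponent qL νL :=
    ⟨hqLrad, hqL.isLevyMeasure, hqL.exists_representation⟩
  constructor
  · intro hsup _ htails hrec
    obtain ⟨ε, hε, hball⟩ := Metric.eventually_nhds_iff_ball.1 hsup
    set r := min ε 1
    have hr : 0 < r := lt_min hε one_pos
    obtain ⟨K, hK, hle⟩ := htails.exists_re_le hLrad (hrad x₀)
    have hdiv : ∫⁻ ξ in Metric.ball (0 : EuclideanSpace ℝ (Fin 2)) r,
        (ENNReal.ofReal (q x₀ ξ).re)⁻¹ = ∞ := by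
      by_cases hνL : ∫⁻ y, ENNReal.ofReal (min 1 (‖y‖ ^ 2)) ∂νL = 0
      -- If `L` has no jumps, both exponents are of order at most `‖ξ‖²`, whose inverse is not
      -- integrable near the origin of the plane.
      · have hνL0 := hLrad.levy.eq_zero_of_lintegral_min_eq_zero hνL
        obtain ⟨K', hK', hle'⟩ := hLrad.exists_re_le
        refine lintegral_inv_const_mul_eq_top measurableSet_ball (K := K * (1 + K'))
          (by positivity) (fun ξ _ => ?_) (lintegral_inv_norm_sq_eq_top hr)
        have h1 := hle' ξ
        rw [hνL0, lintegral_zero_measure, mul_zero, add_zero,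
          ENNReal.ofReal_le_ofReal_iff (by positivity)] at h1
        refine (hle ξ).trans ?_
        rw [mul_assoc]
        refine mul_le_mul_of_nonneg_left ?_ hK.le
        linarith
      · obtain ⟨K', hK', hle'⟩ := hLrad.exists_norm_sq_le hνL
        refine lintegral_inv_const_mul_eq_top measurableSet_ball (K := K * (1 + K'))
          (by positivity) (fun ξ hξ => ?_) (hrec.lintegral_inv_eq_top hL hqL hLrad hr)
        have hξ1 : ‖ξ‖ < 1 := (mem_ball_zero_iff.1 hξ).trans_le (min_le_right _ _)
        refine (hle ξ).trans ?_
        rw [mul_assoc]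
        refine mul_le_mul_of_nonneg_left ?_ hK.le
        linarith [hle' ξ hξ1.le]
    refine ⟨r, hr, top_le_iff.1 (hdiv ▸ setLIntegral_mono' measurableSet_ball fun ξ hξ => ?_)⟩
    refine ENNReal.inv_le_inv.2 (iSup_le fun x => ENNReal.ofReal_le_ofReal ?_)
    rw [← (hrad x).coe_re, Complex.norm_real, Real.norm_of_nonneg ((hrad x).re_nonneg ξ)]
    exact (hball ξ (Metric.ball_subset_ball (min_le_left _ _) hξ)).1 (mem_range_self x)
  · intro hinf _ hmoment htails htrans
    obtain ⟨ε, hε, hball⟩ := Metric.eventually_nhds_iff_ball.1 hinf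
    set r := min ε 1
    have hr : 0 < r := lt_min hε one_pos
    have hν0 : ∫⁻ y, ENNReal.ofReal (min 1 (‖y‖ ^ 2)) ∂(ν x₀) ≠ 0 := fun h0 => by
      simp [(hrad x₀).levy.eq_zero_of_lintegral_min_eq_zero h0] at hmoment
    obtain ⟨K, hK, hle⟩ := htails.exists_re_le (hrad x₀) hLrad
    obtain ⟨K', hK', hle'⟩ := (hrad x₀).exists_norm_sq_le hν0
    have hfin : ∫⁻ ξ in Metric.ball (0 : EuclideanSpace ℝ (Fin 2)) r,
        (ENNReal.ofReal (q x₀ ξ).re)⁻¹ < ∞ := by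
      refine lt_top_iff_ne_top.2 fun htop => ?_
      have h1 := lintegral_inv_const_mul_eq_top measurableSet_ball (f := fun ξ => (qL ξ).re)
        (K := K * (1 + K')) (by positivity) (fun ξ hξ => ?_) htop
      · refine (htrans.lintegral_inv_lt_top hL hqL hLrad).ne (top_le_iff.1 (h1 ▸ ?_))
        exact lintegral_mono_set (Metric.ball_subset_ball (min_le_right _ _))
      · have hξ1 : ‖ξ‖ < 1 := (mem_ball_zero_iff.1 hξ).trans_le (min_le_right _ _)
        refine (hle ξ).trans ?_
        rw [mul_assoc]
        refine mul_le_mul_of_nonneg_left ?_ hK.le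
        linarith [hle' ξ hξ1.le]
    refine ⟨r, hr, lt_of_le_of_lt (setLIntegral_mono' measurableSet_ball fun ξ hξ => ?_) hfin⟩
    refine ENNReal.inv_le_inv.2 (le_iInf fun x => ENNReal.ofReal_le_ofReal ?_)
    exact (hball ξ (Metric.ball_subset_ball (min_le_left _ _) hξ)).1 (mem_range_self x)
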